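/- For each sample size $n$ consider the linear model $Y=X\beta^*+\epsilon$ with a deterministic design $X\in\mathbb R^{n\times p}$, coefficients $\beta^*\in\mathbb R^{p}$ and noise $\epsilon\in\mathbb R^n$, where $p=p_n$, $X=X_n$ and $\beta^*=\beta^*_n$ may depend on $n$. Let $S=\{j:\beta^*_j\neq 0\}$, $s=s_n=|S|$; for index sets $A,B$ let $X_A$ be the submatrix of the columns in $A$; put $C_{11}=\frac1n X_S^TX_S$, $C_{21}=\frac1nX_{S^c}^TX_S$. Let $\hat\beta$ be a Lasso estimator, i.e. a (measurable) minimizer of $\|Y-X\beta\|_2^2+\lambda_n\|\beta\|_1$, with $\lambda_n\ge 0$, and $\hat S=\{j:\hat\beta_j\ne0\}$, $d=|\hat S|$. Lasso+mLS is the estimator $\tilde\beta$ with $\tilde\beta_{\hat S^c}=0$ and $\tilde\beta_{\hat S}=\frac1{\sqrt n}VD^{-}U^TY$, where $\frac1{\sqrt n}X_{\hat S}=UDV^T$ is a singular value decomposition ($U$, $V$ orthogonal of sizes $n$ and $d$, $D$ an $n\times d$ diagonal matrix) and $D^{-}$ is the $d\times n$ diagonal matrix whose entries are the inverses of the singular values,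 with $0$ in place of the inverse of each singular value that is smaller than $\tau_n>0$ (or equal to $0$). Lasso+Ridge is the minimizer $\tilde\beta$ of $\|Y-X\beta\|_2^2+\mu_n\|\beta\|_2^2$ over the $\beta$ with $\beta_{\hat S^c}=0$, where $\mu_n\ge0$. Write $a_n\asymp b_n$ if $a_n=O(b_n)$ and $b_n=O(a_n)$ (so in particular if $a_n$ is a nonzero constant multiple of $b_n$). Assume, with all constants independent of $n$ and with the conditions on $X$ and $\beta^*$ required for all large $n$: (a) $\epsilon_1,\dots,\epsilon_n$ are i.i.d. $N(0,\sigma^2)$ with $\sigma>0$; (b) $\frac1n\sum_{i}x_{ij}=0$ and $\frac1n\sum_i x_{ij}^2=1$ for $j=1,\dots,p$; (c) the smallest eigenvalue of $C_{11}$ is at least $\Lambda_{\min}>0$; (d) $s_n=O(n^{c_1})$ and $p_n=O(e^{n^{c_2}})$, where $0\le c_1<1$ and $0<c_2<1-c_1$; (e) $\tau_n\asymp\frac1n$ and $\mu_n\asymp\frac1n$; (i) $n^{(1-c_3)/2}\,|\beta^*_j|\ge M$ for all $j\in S$, where $M>0$ and $c_1+c_2<c_3\le1$; (j) $\lambda_n\asymp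 n^{(1+c_4)/2}$, where $c_2<c_4<c_3-c_1$; (Irrepresentable condition) every entry of $C_{21}C_{11}^{-1}\operatorname{sign}(\beta^*_S)$ is at most $1-\eta$ in absolute value, where $\eta>0$. Then $P(\hat S=S)\to1$ as $n\to\infty$; and, if $\tilde\beta$ is Lasso+mLS, $$\sup_{t\in\mathbb R^s}\bigl|\hat\Psi(t)-\Psi(t)\bigr|\to0\qquad(n\to\infty),$$ where $\hat\Psi(t)=P\bigl(\sqrt n(\tilde\beta_S-\beta^*_S)\le t\bigr)$ (componentwise inequality) and $\Psi$ is the distribution function of $N(0,\sigma^2C_{11}^{-1})$. If moreover (g) $\frac1n\|X\beta^*\|_2^2=O(n)$, then the same convergence holds for Lasso+Ridge. -/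

import Mathlib

open MeasureTheory ProbabilityTheory Filter Topology Asymptotics
open scoped Matrix NNReal

namespace PostLasso

noncomputable section

variable {n p : ℕ}

/-- The set of predictors `{j : b_j ≠ 0}` carried by a coefficient vector. -/
def supp (b : Fin p → ℝ) : Finset (Fin p) := Finset.univ.filter fun j => b j ≠ 0

/-- The submatrix `X_T` of the columns of `X` with index in `T`. -/
def cols (X : Matrix (Fin n) (Fin p) ℝ) (T : Finset (Fin p)) : Matrix (Fin n) T ℝ :=
  X.submatrix id Subtype.val

/-- The block `(1/n) X_Tᵀ X_U` of the Gram matrix `C = (1/n) Xᵀ X`. -/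
def gram (X : Matrix (Fin n) (Fin p) ℝ) (T U : Finset (Fin p)) : Matrix T U ℝ :=
  (1 / (n : ℝ)) • ((cols X T)ᵀ * cols X U)

theorem gram_isHermitian (X : Matrix (Fin n) (Fin p) ℝ) (T : Finset (Fin p)) :
    (gram X T T).IsHermitian := by
  simp [gram, Matrix.IsHermitian, Matrix.conjTranspose_eq_transpose_of_trivial]

/-- The predictors are standardized: every column of `X` has mean `0` and mean square `1`. -/
def Standardized (X : Matrix (Fin n) (Fin p) ℝ) : Prop :=
  ∀ j, (1 / (n : ℝ)) * ∑ i, X i j = 0 ∧ (1 / (n : ℝ)) * ∑ i, X i j ^ 2 = 1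

/-- All eigenvalues of `C₁₁ = (1/n) X_Sᵀ X_S` are at least `L`, where `S` is the support of `b`. -/
def MinEigenvalueGE (X : Matrix (Fin n) (Fin p) ℝ) (b : Fin p → ℝ) (L : ℝ) : Prop :=
  ∀ k, L ≤ (gram_isHermitian X (supp b)).eigenvalues k

/-- The Irrepresentable condition with margin `η`: every entry of `C₂₁ C₁₁⁻¹ sign(b_S)` is at most
`1 - η` in absolute value. -/
def Irrepresentable (X : Matrix (Fin n) (Fin p) ℝ) (b : Fin p → ℝ) (η : ℝ) : Prop :=
  ∀ j, |((gram X (supp b)ᶜ (supp b) * (gram X (supp b) (supp b))⁻¹) *ᵥ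
    fun k => Real.sign (b k)) j| ≤ 1 - η

/-- The response `Y = X b + e`. -/
def response (X : Matrix (Fin n) (Fin p) ℝ) (b : Fin p → ℝ) (e : Fin n → ℝ) : Fin n → ℝ :=
  X *ᵥ b + e

/-- The residual sum of squares `‖y - X b‖₂²`. -/
def rss (X : Matrix (Fin n) (Fin p) ℝ) (y : Fin n → ℝ) (b : Fin p → ℝ) : ℝ :=
  ∑ i, (y i - (X *ᵥ b) i) ^ 2

/-- `b` is a Lasso estimate: a minimizer of `‖y - X b‖₂² + lam ‖b‖₁`. -/
def IsLasso (X : Matrix (Fin n) (Fin p) ℝ) (y : Fin n → ℝ) (lam : ℝ) (b : Fin p → ℝ) : Prop :=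
  ∀ b' : Fin p → ℝ, rss X y b + lam * ∑ j, |b j| ≤ rss X y b' + lam * ∑ j, |b' j|

/-- `b` is the Ridge estimate on the selected set `T`: a minimizer of `‖y - X b‖₂² + mu ‖b‖₂²`
among the vectors that vanish outside `T`. -/
def IsSelectRidge (X : Matrix (Fin n) (Fin p) ℝ) (y : Fin n → ℝ) (T : Finset (Fin p)) (mu : ℝ)
    (b : Fin p → ℝ) : Prop :=
  (∀ j, j ∉ T → b j = 0) ∧
    ∀ b' : Fin p → ℝ, (∀ j, j ∉ T → b' j = 0) →
      rss X y b + mu * ∑ j, b j ^ 2 ≤ rss X y b' + mu * ∑ j, b' j ^ 2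

/-- The `m × d` rectangular diagonal matrix with diagonal entries `l`. -/
def rectDiag (m d : ℕ) (l : Fin d → ℝ) : Matrix (Fin m) (Fin d) ℝ :=
  Matrix.of fun i j => if i.val = j.val then l j else 0

/-- `A = U D Vᵀ` is a singular value decomposition with singular values `l`, in decreasing order
(only the entries `l j` with `j < n` occur in `D`). -/
def IsSVD {d : ℕ} (A : Matrix (Fin n) (Fin d) ℝ) (U : Matrix (Fin n) (Fin n) ℝ) (l : Fin d → ℝ)
    (V : Matrix (Fin d) (Fin d) ℝ) : Prop :=
  U ∈ Matrix.orthogonalGroup (Fin n) ℝ ∧ V ∈ Matrix.orthogonalGroup (Fin d) ℝ ∧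
    (∀ k, 0 ≤ l k) ∧ Antitone l ∧ A = U * rectDiag n d l * Vᵀ

/-- `X_T` with its columns enumerated in increasing order by `Fin |T|`. -/
def colsFin (X : Matrix (Fin n) (Fin p) ℝ) (T : Finset (Fin p)) :
    Matrix (Fin n) (Fin T.card) ℝ :=
  X.submatrix id (T.orderEmbOfFin rfl)

/-- `b` is the modified least squares estimate on the selected set `T` with threshold `tau`: it
vanishes outside `T`, and on `T` it is `n^{-1/2} V D⁻ Uᵀ y`, where `n^{-1/2} X_T = U D Vᵀ` is a
singular value decomposition and `D⁻` is the `d × n` diagonal matrix of the inverses of the singular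
values, with `0` in place of the inverse of a singular value below `tau`. -/
def IsSelectMLS (X : Matrix (Fin n) (Fin p) ℝ) (y : Fin n → ℝ) (T : Finset (Fin p)) (tau : ℝ)
    (b : Fin p → ℝ) : Prop :=
  (∀ j, j ∉ T → b j = 0) ∧
    ∃ (U : Matrix (Fin n) (Fin n) ℝ) (l : Fin T.card → ℝ) (V : Matrix (Fin T.card) (Fin T.card) ℝ),
      IsSVD ((1 / √(n : ℝ)) • colsFin X T) U l V ∧
      (fun k => b (T.orderEmbOfFin rfl k)) =
        (1 / √(n : ℝ)) •
          ((V * (rectDiag n T.card fun k => if l k < tau then 0 else (l k)⁻¹)ᵀ * Uᵀ) *ᵥ y)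

/-- The distribution function `t ↦ P(√n (b̃_S - b_S) ≤ t)` (componentwise inequality) of the scaled
error of an estimator `bt` of `b` on the support `S` of `b`. -/
def errorCDF {Ω : Type*} [MeasurableSpace Ω] (P : Measure Ω) (n : ℕ) (b : Fin p → ℝ)
    (bt : Ω → Fin p → ℝ) (t : supp b → ℝ) : ℝ :=
  P.real {ω | ∀ j : supp b, √(n : ℝ) * (bt ω j - b j) ≤ t j}

/-- The distribution function of `N(0, σ² C₁₁⁻¹)`. -/
def oracleCDF (X : Matrix (Fin n) (Fin p) ℝ) (b : Fin p → ℝ) (σ : ℝ≥0) (t : supp b → ℝ) : ℝ :=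
  (multivariateGaussian (0 : EuclideanSpace ℝ (supp b))
    ((σ : ℝ) ^ 2 • (gram X (supp b) (supp b))⁻¹)).real {z | ∀ j, z j ≤ t j}

end

end PostLasso

/-! Everything is reduced to one event of probability tending to one. Let `W = (1/n) C₁₁⁻¹ X_Sᵀ ε`
be the least squares error on the true support. On `goodEvent`, `|W j| < |β j| / 2` on `S`, and each
column off `S`, after projecting out `X_S`, has inner product with `ε` below a threshold of the
order of the penalty. Gaussian tails and a union bound over the `p` columns give failure probability
of order `p (exp(-a n^c₃) + exp(-b n^c₄))`, which vanishes because `c₃, c₄ > c₂`.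

Selection is a primal-dual witness argument (`supp_eq_of_isLasso`). Freezing the signs at `sign β_S`
gives the candidate `β_S + W - (lam/2n) C₁₁⁻¹ sign β_S`, zero off `S`. Its bias is of order
`n^((c₄+c₁-1)/2)`, negligible against the minimal signal `n^((c₃-1)/2)`, so the signs are right. The
Irrepresentable condition makes it strictly dual feasible off `S`, and then every Lasso estimate
equals it (`eq_of_isLasso`).

For the second stage, both estimators solve Ridge normal equations on `S` on this event, with
penalty `0` for mLS and `μ` for Ridge, and so lie within a deterministic distance of `β_S + W`. As
`√n W` has exactly the law `N(0, σ² C₁₁⁻¹)`, no central limit theorem is needed. Its coordinates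
have variance at least `σ²`, so an error `δ` changes the distribution function by at most `s δ / σ`,
uniformly in `t` (`abs_errorCDF_sub_oracleCDF_le`). For mLS `δ = 0`; for Ridge, (g) yields `s δ =
O(s / n)`. -/

namespace PostLasso

/-! ### Gram matrices, the least squares operator and residual columns. -/

section LinearAlgebra

variable {n p : ℕ}

theorem mulVec_eq_cols_mulVec (X : Matrix (Fin n) (Fin p) ℝ) {T : Finset (Fin p)}
    {b : Fin p → ℝ} (hb : ∀ j, j ∉ T → b j = 0) :
    X *ᵥ b = cols X T *ᵥ fun k => b k := by
  ext i
  simp only [Matrix.mulVec, dotProduct, cols, Matrix.submatrix_apply, id]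
  rw [Finset.sum_coe_sort T (fun j => X i j * b j)]
  exact (Finset.sum_subset (Finset.subset_univ T) fun j _ hj => by simp [hb j hj]).symm

theorem mulVec_eq_colsFin_mulVec (X : Matrix (Fin n) (Fin p) ℝ) {T : Finset (Fin p)}
    {b : Fin p → ℝ} (hb : ∀ j, j ∉ T → b j = 0) :
    X *ᵥ b = colsFin X T *ᵥ fun k => b (T.orderEmbOfFin rfl k) := by
  rw [mulVec_eq_cols_mulVec X hb]
  ext i
  simp only [Matrix.mulVec, dotProduct, cols, colsFin, Matrix.submatrix_apply, id]
  rw [← (T.orderIsoOfFin rfl).toEquiv.sum_comp]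
  rfl

/-- A lower bound on the eigenvalues of a symmetric matrix bounds its quadratic form. -/
theorem le_quadratic_form_of_le_eigenvalues {ι : Type*} [Fintype ι] [DecidableEq ι]
    {A : Matrix ι ι ℝ} (hA : A.IsHermitian) {L : ℝ} (h : ∀ k, L ≤ hA.eigenvalues k)
    (v : ι → ℝ) : L * (v ⬝ᵥ v) ≤ v ⬝ᵥ A *ᵥ v := by
  -- Subtracting `L • 1` shifts the spectrum by `-L`, which turns the eigenvalue bound into positive
  -- semidefiniteness.
  have hB : (A - L • (1 : Matrix ι ι ℝ)).IsHermitian := by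
    refine hA.sub ?_
    simp [Matrix.IsHermitian]
  have hpos : (A - L • (1 : Matrix ι ι ℝ)).PosSemidef := by
    rw [hB.posSemidef_iff_eigenvalues_nonneg]
    intro k
    have hk := hB.eigenvalues_mem_spectrum_real k
    have h2 : hB.eigenvalues k + L ∈ spectrum ℝ A := by
      have := (spectrum.add_mem_add_iff (a := A - L • (1 : Matrix ι ι ℝ))
        (r := hB.eigenvalues k) (s := L)).2 hk
      rwa [Algebra.algebraMap_eq_smul_one, add_sub_cancel] at this
    rw [hA.spectrum_real_eq_range_eigenvalues] at h2
    obtain ⟨m, hm⟩ := h2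
    have := h m
    simp only [Pi.zero_apply]
    linarith
  have := hpos.dotProduct_mulVec_nonneg v
  simp only [star_trivial, Matrix.sub_mulVec, Matrix.smul_mulVec, Matrix.one_mulVec,
    dotProduct_sub, dotProduct_smul, smul_eq_mul] at this
  linarith

/-- Expand `‖w - L u‖² ≥ 0`. With `w = C u` this bounds the inverse of a coercive `C` by `1 / L`
without operator norms. -/
theorem sq_mul_dotProduct_le {ι : Type*} [Fintype ι] {u w : ι → ℝ} {L : ℝ} (hL : 0 ≤ L)
    (h : L * (u ⬝ᵥ u) ≤ u ⬝ᵥ w) : L ^ 2 * (u ⬝ᵥ u) ≤ w ⬝ᵥ w := by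
  have h0 : 0 ≤ (w - L • u) ⬝ᵥ (w - L • u) := by
    rw [dotProduct]
    exact Finset.sum_nonneg fun i _ => mul_self_nonneg _
  simp only [sub_dotProduct, dotProduct_sub, smul_dotProduct, dotProduct_smul, smul_eq_mul,
    dotProduct_comm w u] at h0
  nlinarith [mul_le_mul_of_nonneg_left h hL]

theorem sq_le_dotProduct_self {ι : Type*} [Fintype ι] (u : ι → ℝ) (j : ι) :
    u j ^ 2 ≤ u ⬝ᵥ u := by
  rw [dotProduct, sq]
  exact Finset.single_le_sum (f := fun i => u i * u i) (fun i _ => mul_self_nonneg _)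
    (Finset.mem_univ j)

theorem dotProduct_self_nonneg' {ι : Type*} [Fintype ι] (u : ι → ℝ) : 0 ≤ u ⬝ᵥ u :=
  Finset.sum_nonneg fun _ _ => mul_self_nonneg _

variable (X : Matrix (Fin n) (Fin p) ℝ) (T : Finset (Fin p))

/-- The quadratic form of `C_TT` is bounded below by `L`. -/
def GramCoercive (L : ℝ) : Prop :=
  ∀ v : T → ℝ, L * (v ⬝ᵥ v) ≤ v ⬝ᵥ gram X T T *ᵥ v

/-- The least squares operator `(1/n) C_TT⁻¹ X_Tᵀ`. -/
noncomputable def olsMatrix : Matrix T (Fin n) ℝ :=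
  (1 / (n : ℝ)) • ((gram X T T)⁻¹ * (cols X T)ᵀ)

theorem dotProduct_gram_mulVec (v : T → ℝ) :
    v ⬝ᵥ gram X T T *ᵥ v = (1 / (n : ℝ)) * ((cols X T *ᵥ v) ⬝ᵥ (cols X T *ᵥ v)) := by
  rw [gram, Matrix.smul_mulVec, dotProduct_smul, smul_eq_mul, ← Matrix.mulVec_mulVec,
    Matrix.dotProduct_mulVec, Matrix.vecMul_transpose]

variable {X T} {L : ℝ}

theorem GramCoercive.posDef (h : GramCoercive X T L) (hL : 0 < L) : (gram X T T).PosDef := by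
  refine Matrix.PosDef.of_dotProduct_mulVec_pos (gram_isHermitian X T) fun v hv => ?_
  rw [star_trivial]
  refine lt_of_lt_of_le (mul_pos hL ?_) (h v)
  refine lt_of_le_of_ne (dotProduct_self_nonneg' v) (Ne.symm ?_)
  simpa [dotProduct_self_eq_zero] using hv

theorem GramCoercive.mul_inv (h : GramCoercive X T L) (hL : 0 < L) :
    gram X T T * (gram X T T)⁻¹ = 1 :=
  Matrix.mul_nonsing_inv _ ((Matrix.isUnit_iff_isUnit_det _).1 (h.posDef hL).isUnit)

theorem GramCoercive.inv_mul (h : GramCoercive X T L) (hL : 0 < L) :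
    (gram X T T)⁻¹ * gram X T T = 1 :=
  Matrix.nonsing_inv_mul _ ((Matrix.isUnit_iff_isUnit_det _).1 (h.posDef hL).isUnit)

theorem GramCoercive.sq_mul_inv_mulVec_le (h : GramCoercive X T L) (hL : 0 < L) (w : T → ℝ) :
    L ^ 2 * (((gram X T T)⁻¹ *ᵥ w) ⬝ᵥ ((gram X T T)⁻¹ *ᵥ w)) ≤ w ⬝ᵥ w := by
  refine sq_mul_dotProduct_le hL.le ((h _).trans_eq ?_)
  rw [Matrix.mulVec_mulVec, h.mul_inv hL, Matrix.one_mulVec]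

theorem GramCoercive.inv_diag_le (h : GramCoercive X T L) (hL : 0 < L) (j : T) :
    (gram X T T)⁻¹ j j ≤ 1 / L := by
  set x : T → ℝ := (gram X T T)⁻¹ *ᵥ Pi.single j 1 with hx
  have hxj : x j = (gram X T T)⁻¹ j j := by simp [hx]
  have h1 := h.sq_mul_inv_mulVec_le hL (Pi.single j 1)
  rw [← hx] at h1
  have h2 := sq_le_dotProduct_self x j
  have h3 : (Pi.single j 1 : T → ℝ) ⬝ᵥ Pi.single j 1 = 1 := by simp
  rw [h3] at h1
  rw [← hxj, le_div_iff₀ hL]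
  have : (x j * L) ^ 2 ≤ 1 := by nlinarith [mul_le_mul_of_nonneg_left h2 (sq_nonneg L)]
  exact (abs_le.1 ((sq_le_one_iff_abs_le_one _).1 this)).2

theorem GramCoercive.olsMatrix_mul_cols (h : GramCoercive X T L) (hL : 0 < L) :
    olsMatrix X T * cols X T = 1 := by
  rw [olsMatrix, Matrix.smul_mul, Matrix.mul_assoc, ← Matrix.mul_smul]
  exact h.inv_mul hL

theorem GramCoercive.gram_mul_olsMatrix (h : GramCoercive X T L) (hL : 0 < L) :
    gram X T T * olsMatrix X T = (1 / (n : ℝ)) • (cols X T)ᵀ := by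
  rw [olsMatrix, Matrix.mul_smul, ← Matrix.mul_assoc, h.mul_inv hL, Matrix.one_mul]

theorem gram_inv_transpose : ((gram X T T)⁻¹)ᵀ = (gram X T T)⁻¹ := by
  have := (gram_isHermitian X T).inv
  rwa [Matrix.IsHermitian, Matrix.conjTranspose_eq_transpose_of_trivial] at this

theorem olsMatrix_transpose :
    (olsMatrix X T)ᵀ = (1 / (n : ℝ)) • (cols X T * (gram X T T)⁻¹) := by
  rw [olsMatrix, Matrix.transpose_smul, Matrix.transpose_mul, Matrix.transpose_transpose,
    gram_inv_transpose]

theorem GramCoercive.olsMatrix_mul_transpose (h : GramCoercive X T L) (hL : 0 < L) :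
    olsMatrix X T * (olsMatrix X T)ᵀ = (1 / (n : ℝ)) • (gram X T T)⁻¹ := by
  rw [olsMatrix_transpose, Matrix.mul_smul, ← Matrix.mul_assoc, h.olsMatrix_mul_cols hL,
    Matrix.one_mul]

theorem GramCoercive.sum_olsMatrix_sq (h : GramCoercive X T L) (hL : 0 < L) (j : T) :
    ∑ i, olsMatrix X T j i ^ 2 = (1 / (n : ℝ)) * (gram X T T)⁻¹ j j := by
  have := congrFun (congrFun (h.olsMatrix_mul_transpose hL) j) j
  simpa [Matrix.mul_apply, sq] using this

theorem GramCoercive.sum_olsMatrix_sq_le (h : GramCoercive X T L) (hL : 0 < L) (j : T) :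
    ∑ i, olsMatrix X T j i ^ 2 ≤ 1 / (n * L) := by
  rw [h.sum_olsMatrix_sq hL, one_div_mul_eq_div, mul_comm, ← div_div]
  exact div_le_div_of_nonneg_right (h.inv_diag_le hL j) (Nat.cast_nonneg n)

/-- Cauchy-Schwarz: row `j` of the least squares operator has inner product `1` with `X_j`, and
`‖X_j‖² = n`. Hence `√n W j` has variance at least `σ²`, with no upper eigenvalue bound on `C₁₁`. -/
theorem GramCoercive.one_le_sum_olsMatrix_sq (h : GramCoercive X T L) (hL : 0 < L) (j : T)
    (hX : ∑ i, X i j ^ 2 = n) : 1 ≤ n * ∑ i, olsMatrix X T j i ^ 2 := by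
  have h1 := congrFun (congrFun (h.olsMatrix_mul_cols hL) j) j
  rw [Matrix.mul_apply, Matrix.one_apply_eq] at h1
  have h2 := Finset.sum_mul_sq_le_sq_mul_sq Finset.univ (fun i => olsMatrix X T j i)
    (fun i => cols X T i j)
  rw [h1] at h2
  simp only [cols, Matrix.submatrix_apply, id, hX] at h2
  linarith

/-- The normal vector of column `j` relative to the columns in `T`: the residual of the
regression of `X_j` on `X_T`. -/
noncomputable def residualCol (X : Matrix (Fin n) (Fin p) ℝ) (T : Finset (Fin p)) (j : Fin p) :
    Fin n → ℝ :=
  X.col j - cols X T *ᵥ (olsMatrix X T *ᵥ X.col j)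

theorem GramCoercive.transpose_mul_ols (h : GramCoercive X T L) (hL : 0 < L) (hn : 0 < n) :
    (cols X T)ᵀ * cols X T * olsMatrix X T = (cols X T)ᵀ := by
  have hn' : (n : ℝ) ≠ 0 := by positivity
  have h1 := h.gram_mul_olsMatrix hL
  rw [gram, Matrix.smul_mul] at h1
  exact smul_right_injective _ (one_div_ne_zero hn') h1

/-- Pythagoras: the residual is orthogonal to the fitted part. -/
theorem GramCoercive.dotProduct_residualCol_le (h : GramCoercive X T L) (hL : 0 < L) (hn : 0 < n)
    (j : Fin p) : residualCol X T j ⬝ᵥ residualCol X T j ≤ X.col j ⬝ᵥ X.col j := by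
  set x := X.col j
  set a := residualCol X T j with ha
  set q := cols X T *ᵥ (olsMatrix X T *ᵥ x) with hq
  have hx : x = a + q := by simp [ha, residualCol, hq, x]
  have horth : q ⬝ᵥ a = 0 := by
    have : (cols X T)ᵀ *ᵥ a = 0 := by
      rw [ha, residualCol, Matrix.mulVec_sub, Matrix.mulVec_mulVec, Matrix.mulVec_mulVec,
        h.transpose_mul_ols hL hn, sub_self]
    rw [hq, dotProduct_comm, Matrix.dotProduct_mulVec, ← Matrix.mulVec_transpose, this,
      zero_dotProduct]
  rw [hx]
  simp only [add_dotProduct, dotProduct_add, horth, dotProduct_comm a q]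
  have := dotProduct_self_nonneg' q
  linarith

/-- The projection is symmetric, so the residual column can be moved onto the noise. -/
theorem residualCol_dotProduct (j : Fin p) (e : Fin n → ℝ) :
    residualCol X T j ⬝ᵥ e = X.col j ⬝ᵥ (e - cols X T *ᵥ (olsMatrix X T *ᵥ e)) := by
  rw [residualCol, sub_dotProduct, dotProduct_sub]
  congr 1
  rw [Matrix.mulVec_mulVec, Matrix.mulVec_mulVec, dotProduct_comm, Matrix.dotProduct_mulVec,
    ← Matrix.mulVec_transpose, dotProduct_comm, Matrix.transpose_mul, olsMatrix_transpose,
    olsMatrix, Matrix.smul_mul, Matrix.mul_smul, Matrix.mul_assoc]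

end LinearAlgebra

end PostLasso

namespace PostLasso

/-! ### Optimality conditions for the Lasso and Ridge. -/

section Deterministic

variable {n p : ℕ} {X : Matrix (Fin n) (Fin p) ℝ} {T : Finset (Fin p)} {L : ℝ}

theorem rss_eq_dotProduct (X : Matrix (Fin n) (Fin p) ℝ) (y : Fin n → ℝ) (b : Fin p → ℝ) :
    rss X y b = (y - X *ᵥ b) ⬝ᵥ (y - X *ᵥ b) := by
  simp [rss, dotProduct, sq]

theorem rss_add (X : Matrix (Fin n) (Fin p) ℝ) (y : Fin n → ℝ) (w v : Fin p → ℝ) :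
    rss X y (w + v) = rss X y w + (X *ᵥ v) ⬝ᵥ (X *ᵥ v) -
      2 * ∑ j, (X.col j ⬝ᵥ (y - X *ᵥ w)) * v j := by
  have h : ∑ j, (X.col j ⬝ᵥ (y - X *ᵥ w)) * v j = (y - X *ᵥ w) ⬝ᵥ (X *ᵥ v) := by
    rw [Matrix.dotProduct_mulVec, dotProduct]
    refine Finset.sum_congr rfl fun j _ => ?_
    rw [dotProduct_comm]
    rfl
  rw [h, rss_eq_dotProduct, rss_eq_dotProduct, Matrix.mulVec_add, ← sub_sub]
  generalize y - X *ᵥ w = r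
  simp only [sub_dotProduct, dotProduct_sub, dotProduct_comm (X *ᵥ v) r]
  ring

theorem GramCoercive.mul_sum_sq_le (h : GramCoercive X T L) (hn : 0 < n) {v : Fin p → ℝ}
    (hv : ∀ j, j ∉ T → v j = 0) :
    n * L * ((fun k : T => v k) ⬝ᵥ fun k : T => v k) ≤ (X *ᵥ v) ⬝ᵥ (X *ᵥ v) := by
  have h1 := h fun k => v k
  rw [dotProduct_gram_mulVec, ← mulVec_eq_cols_mulVec X hv] at h1
  have hn' : (0 : ℝ) < n := by positivity
  rw [one_div_mul_eq_div, le_div_iff₀ hn'] at h1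
  linarith

/-- Strict dual feasibility determines the Lasso estimate. -/
theorem eq_of_isLasso (h : GramCoercive X T L) (hL : 0 < L) (hn : 0 < n) {y : Fin n → ℝ}
    {lam : ℝ} {b w : Fin p → ℝ} (hw : ∀ j, j ∉ T → w j = 0)
    (hin : ∀ j ∈ T, 2 * |X.col j ⬝ᵥ (y - X *ᵥ w)| ≤ lam)
    (hsgn : ∀ j ∈ T, 2 * ((X.col j ⬝ᵥ (y - X *ᵥ w)) * w j) = lam * |w j|)
    (hout : ∀ j, j ∉ T → 2 * |X.col j ⬝ᵥ (y - X *ᵥ w)| < lam) (hb : IsLasso X y lam b) :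
    b = w := by
  set g : Fin p → ℝ := fun j => X.col j ⬝ᵥ (y - X *ᵥ w) with hg
  have h1 := hb w
  have h2 := rss_add X y w (b - w)
  rw [add_sub_cancel] at h2
  rw [h2] at h1
  have hq := dotProduct_self_nonneg' (X *ᵥ (b - w))
  have hterm : ∀ j, 0 ≤ lam * |b j| - 2 * (g j * b j) := by
    intro j
    have hj : 2 * |g j| ≤ lam := by
      by_cases hjT : j ∈ T
      · exact hin j hjT
      · exact (hout j hjT).le
    have := le_abs_self (g j * b j)
    rw [abs_mul] at this
    nlinarith [mul_le_mul_of_nonneg_right hj (abs_nonneg (b j))]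
  have hw0 : ∀ j, lam * |w j| - 2 * (g j * w j) = 0 := by
    intro j
    by_cases hjT : j ∈ T
    · rw [sub_eq_zero]; exact (hsgn j hjT).symm
    · simp [hw j hjT]
  have hsum : ∑ j, (lam * |b j| - 2 * (g j * b j)) - ∑ j, (lam * |w j| - 2 * (g j * w j)) =
      lam * ∑ j, |b j| - lam * ∑ j, |w j| - 2 * ∑ j, g j * (b - w) j := by
    simp only [Finset.mul_sum, ← Finset.sum_sub_distrib]
    refine Finset.sum_congr rfl fun j _ => ?_
    simp only [Pi.sub_apply]
    ring
  rw [Finset.sum_eq_zero (fun j _ => hw0 j), sub_zero] at hsum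
  have hS0 : 0 ≤ ∑ j, (lam * |b j| - 2 * (g j * b j)) := Finset.sum_nonneg fun j _ => hterm j
  -- The objective at `b` exceeds that at `w` by `‖X (b - w)‖²` plus this nonnegative sum.
  -- Minimality of `b` forces both to vanish.
  have hS : ∑ j, (lam * |b j| - 2 * (g j * b j)) = 0 := by
    change _ + _ - 2 * ∑ j, g j * (b - w) j + _ ≤ _ at h1
    linarith
  have hQ : (X *ᵥ (b - w)) ⬝ᵥ (X *ᵥ (b - w)) ≤ 0 := by
    change _ + _ - 2 * ∑ j, g j * (b - w) j + _ ≤ _ at h1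
    linarith
  -- Strict feasibility makes the `j`-th term positive unless `b j = 0`. Coercivity on `T` then
  -- gives `b = w` from `X (b - w) = 0`.
  have hbT : ∀ j, j ∉ T → b j = 0 := by
    intro j hj
    have h3 := (Finset.sum_eq_zero_iff_of_nonneg fun j _ => hterm j).1 hS j (Finset.mem_univ j)
    have h4 := le_abs_self (g j * b j)
    rw [abs_mul] at h4
    by_contra hne
    have := mul_lt_mul_of_pos_right (hout j hj) (abs_pos.2 hne)
    change 2 * |g j| * _ < _ at this
    linarith
  have hbw : ∀ j, j ∉ T → (b - w) j = 0 := fun j hj => by simp [hbT j hj, hw j hj]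
  have h5 := h.mul_sum_sq_le hn hbw
  have hnL : 0 < n * L := by positivity
  have h6 : (fun k : T => (b - w) k) ⬝ᵥ (fun k : T => (b - w) k) = 0 := by
    refine le_antisymm ?_ (dotProduct_self_nonneg' _)
    by_contra hlt
    have := mul_pos hnL (not_le.1 hlt)
    linarith
  rw [dotProduct_self_eq_zero] at h6
  ext j
  by_cases hj : j ∈ T
  · have := congrFun h6 ⟨j, hj⟩
    simpa [sub_eq_zero] using this
  · rw [hbT j hj, hw j hj]

theorem mem_supp {b : Fin p → ℝ} {j : Fin p} : j ∈ supp b ↔ b j ≠ 0 := by simp [supp]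

theorem eq_zero_of_notMem_supp {b : Fin p → ℝ} {j : Fin p} (h : j ∉ supp b) : b j = 0 := by
  simpa [supp] using h

theorem abs_real_sign_le_one (x : ℝ) : |Real.sign x| ≤ 1 := by
  rcases Real.sign_apply_eq x with h | h | h <;> simp [h]

theorem real_sign_mul_eq_abs {x w : ℝ} (h : |w - x| < |x|) : Real.sign x * w = |w| := by
  rcases lt_trichotomy x 0 with hx | hx | hx
  · rw [abs_of_neg hx, abs_lt] at h
    rw [Real.sign_of_neg hx, abs_of_neg (by linarith), neg_one_mul]
  · simp [hx] at h
    exact absurd h (not_lt.2 (abs_nonneg _))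
  · rw [abs_of_pos hx, abs_lt] at h
    rw [Real.sign_of_pos hx, abs_of_pos (by linarith), one_mul]

variable {β : Fin p → ℝ}

/-- `C₁₁⁻¹ sign(β_S)`. -/
noncomputable def dualVector (X : Matrix (Fin n) (Fin p) ℝ) (β : Fin p → ℝ) : supp β → ℝ :=
  (gram X (supp β) (supp β))⁻¹ *ᵥ fun k : supp β => Real.sign (β k)

/-- The Lasso selects the support of `β` when the noise is small relative to the penalty, and the
penalty relative to the nonzero coefficients. -/
theorem supp_eq_of_isLasso (h : GramCoercive X (supp β) L) (hL : 0 < L) (hn : 0 < n)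
    {e : Fin n → ℝ} {lam η : ℝ} (hlam : 0 < lam) (hIC : Irrepresentable X β η)
    (hnoise : ∀ j : supp β, |(olsMatrix X (supp β) *ᵥ e) j| < |β j| / 2)
    (hbias : ∀ j, lam / (2 * n) * |dualVector X β j| ≤ |β j| / 2)
    (hdual : ∀ j, j ∉ supp β → |residualCol X (supp β) j ⬝ᵥ e| < lam * η / 2)
    {b : Fin p → ℝ} (hb : IsLasso X (response X β e) lam b) : supp b = supp β := by
  classical
  have hn' : (n : ℝ) ≠ 0 := by positivity
  set Z := cols X (supp β) with hZ
  set z := dualVector X β with hz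
  -- `D` solves the stationarity equations on the support with signs frozen at those of `β`. The `2`
  -- in `lam / (2 * n)` comes from the residual sum of squares having no factor `1/2`.
  set D : supp β → ℝ := olsMatrix X (supp β) *ᵥ e - (lam / (2 * n)) • z with hD
  let w : Fin p → ℝ := fun j => if hj : j ∈ supp β then β j + D ⟨j, hj⟩ else 0
  have hwS : ∀ j : supp β, w j = β j + D j := fun j => by simp [w]
  have hwout : ∀ j, j ∉ supp β → w j = 0 := fun j hj => by simp only [w, dif_neg hj]
  have hXw : response X β e - X *ᵥ w = e - Z *ᵥ D := by
    have : (fun k : supp β => w k) = (fun k : supp β => β k) + D := by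
      ext k; exact hwS k
    rw [response, mulVec_eq_cols_mulVec X hwout, this, Matrix.mulVec_add,
      mulVec_eq_cols_mulVec X fun j hj => eq_zero_of_notMem_supp hj]
    abel
  have hr : e - Z *ᵥ D =
      (e - Z *ᵥ (olsMatrix X (supp β) *ᵥ e)) + (lam / (2 * n)) • (Z *ᵥ z) := by
    rw [hD, Matrix.mulVec_sub, Matrix.mulVec_smul]
    abel
  have hgram : gram X (supp β) (supp β) *ᵥ z = fun k : supp β => Real.sign (β k) := by
    rw [hz, dualVector, Matrix.mulVec_mulVec, h.mul_inv hL, Matrix.one_mulVec]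
  have hinS : Zᵀ *ᵥ (e - Z *ᵥ D) = (lam / 2) • fun k : supp β => Real.sign (β k) := by
    rw [hr, Matrix.mulVec_add, Matrix.mulVec_sub, Matrix.mulVec_mulVec, Matrix.mulVec_mulVec,
      h.transpose_mul_ols hL hn, sub_self, zero_add, Matrix.mulVec_smul, Matrix.mulVec_mulVec,
      ← hgram, gram, Matrix.smul_mulVec, smul_smul]
    congr 1
    field_simp
  have hcolin : ∀ j (hj : j ∈ supp β), X.col j ⬝ᵥ (response X β e - X *ᵥ w) =
      lam / 2 * Real.sign (β j) := by
    intro j hj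
    rw [hXw]
    exact congrFun hinS ⟨j, hj⟩
  have hcolout : ∀ j (hj : j ∉ supp β), X.col j ⬝ᵥ (response X β e - X *ᵥ w) =
      residualCol X (supp β) j ⬝ᵥ e + lam / 2 *
      ((gram X (supp β)ᶜ (supp β) * (gram X (supp β) (supp β))⁻¹) *ᵥ
        fun k => Real.sign (β k)) ⟨j, by simpa using hj⟩ := by
    intro j hj
    rw [hXw, hr, dotProduct_add, ← residualCol_dotProduct, ← Matrix.mulVec_mulVec]
    change _ = _ + _ * (gram X (supp β)ᶜ (supp β) *ᵥ z) _
    rw [gram, Matrix.smul_mulVec, ← Matrix.mulVec_mulVec, dotProduct_smul, Pi.smul_apply,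
      smul_eq_mul, smul_eq_mul, ← mul_assoc]
    congr 2
    field_simp
  have hDlt : ∀ j : supp β, |w j - β j| < |β j| := by
    intro j
    rw [hwS, add_sub_cancel_left, hD]
    have h1 := hnoise j
    have h2 := hbias j
    have h3 := abs_sub ((olsMatrix X (supp β) *ᵥ e) j) ((lam / (2 * n)) * z j)
    rw [abs_mul, abs_of_nonneg (by positivity : 0 ≤ lam / (2 * n))] at h3
    simp only [Pi.sub_apply, Pi.smul_apply, smul_eq_mul]
    linarith
  have hbw : b = w := by
    refine eq_of_isLasso h hL hn hwout ?_ ?_ ?_ hb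
    · intro j hj
      rw [hcolin j hj, abs_mul, abs_of_pos (by positivity : 0 < lam / 2)]
      nlinarith [abs_real_sign_le_one (β j)]
    · intro j hj
      rw [hcolin j hj, mul_assoc, real_sign_mul_eq_abs (hDlt ⟨j, hj⟩)]
      ring
    -- The noise part is below `lam * η / 2` and the Irrepresentable part at most `lam * (1 - η) /
    -- 2`, so their sum is strictly below `lam / 2`.
    · intro j hj
      rw [hcolout j hj]
      have h1 := hdual j hj
      have h2 := hIC ⟨j, by simpa using hj⟩
      have h3 := abs_add_le (residualCol X (supp β) j ⬝ᵥ e) (lam / 2 *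
        ((gram X (supp β)ᶜ (supp β) * (gram X (supp β) (supp β))⁻¹) *ᵥ
        fun k => Real.sign (β k)) ⟨j, by simpa using hj⟩)
      rw [abs_mul, abs_of_pos (by positivity : 0 < lam / 2)] at h3
      nlinarith [mul_le_mul_of_nonneg_left h2 (by positivity : 0 ≤ lam / 2)]
  rw [hbw]
  ext j
  constructor
  · intro hj
    by_contra hne
    exact mem_supp.1 hj (hwout j hne)
  · intro hj
    rw [mem_supp]
    intro h0
    have := hDlt ⟨j, hj⟩
    simp [h0] at this

/-- The normal equations of the Ridge regression of `y` on `X_T` with penalty `m`. -/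
def NormalEquations (X : Matrix (Fin n) (Fin p) ℝ) (y : Fin n → ℝ) (T : Finset (Fin p)) (m : ℝ)
    (b : Fin p → ℝ) : Prop :=
  (∀ j, j ∉ T → b j = 0) ∧ ∀ j ∈ T, X.col j ⬝ᵥ (y - X *ᵥ b) = m * b j

/-- Near `0` a linear term cannot be dominated by a quadratic one. This serves as the first-order
condition without derivatives. -/
theorem eq_zero_of_forall_mul_le {g q : ℝ} (h : ∀ t : ℝ, t * g ≤ t ^ 2 * q) : g = 0 := by
  by_contra hg
  have hg2 : 0 < g ^ 2 := by positivity
  have h1 := h (g / (2 * (|q| + 1)))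
  have hq : 0 < |q| + 1 := by positivity
  have h2 : (g / (2 * (|q| + 1))) ^ 2 * q ≤ (g / (2 * (|q| + 1))) ^ 2 * (|q| + 1) :=
    mul_le_mul_of_nonneg_left (by linarith [le_abs_self q]) (sq_nonneg _)
  have h3 : (g / (2 * (|q| + 1))) ^ 2 * (|q| + 1) = g ^ 2 / (4 * (|q| + 1)) := by
    field_simp; ring
  have h4 : g / (2 * (|q| + 1)) * g = 2 * (g ^ 2 / (4 * (|q| + 1))) := by
    field_simp; ring
  have h5 : 0 < g ^ 2 / (4 * (|q| + 1)) := by positivity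
  linarith

theorem IsSelectRidge.normalEquations {y : Fin n → ℝ} {mu : ℝ} {b : Fin p → ℝ}
    (h : IsSelectRidge X y T mu b) : NormalEquations X y T mu b := by
  classical
  -- Moving `b j` by `t` changes the objective by `t² (‖X_j‖² + mu) - 2 t g` with `g = X_j · (y - X
  -- b) - mu b_j`; halving gives this `q`.
  refine ⟨h.1, fun j hj => sub_eq_zero.1 (eq_zero_of_forall_mul_le
    (q := ((X.col j ⬝ᵥ X.col j) + mu) / 2) fun t => ?_)⟩
  have hb := h.2 (b + Pi.single j t) (by
    intro k hk
    have : k ≠ j := fun hkj => hk (hkj ▸ hj)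
    simp [h.1 k hk, this])
  rw [rss_add] at hb
  have h1 : X *ᵥ Pi.single j t = t • X.col j := by
    ext i
    simp [mul_comm]
  have h2 : ∑ k, (X.col k ⬝ᵥ (y - X *ᵥ b)) * (Pi.single j t : Fin p → ℝ) k =
      (X.col j ⬝ᵥ (y - X *ᵥ b)) * t := by
    rw [Finset.sum_eq_single j] <;> simp +contextual
  have h3 : ∑ k, (b + Pi.single j t : Fin p → ℝ) k ^ 2 = ∑ k, b k ^ 2 + (2 * b j * t + t ^ 2) := by
    have : ∀ k, (b + Pi.single j t : Fin p → ℝ) k ^ 2 = b k ^ 2 +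
        (2 * b k * (Pi.single j t : Fin p → ℝ) k + (Pi.single j t : Fin p → ℝ) k ^ 2) := by
      intro k; simp only [Pi.add_apply]; ring
    simp only [this, Finset.sum_add_distrib]
    congr 2
    · rw [Finset.sum_eq_single j] <;> simp +contextual
    · rw [Finset.sum_eq_single j] <;> simp +contextual
  rw [h1, h2, h3, smul_dotProduct, dotProduct_smul, smul_eq_mul, smul_eq_mul] at hb
  nlinarith

end Deterministic

/-! ### The truncated pseudo-inverse. -/

section SVD

variable {n d : ℕ}

/-- The guard `k.val < n` is needed because `d` may exceed `n`; later entries of `l` do not occur in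
the matrix. -/
theorem rectDiag_transpose_mul_rectDiag (l : Fin d → ℝ) :
    (rectDiag n d l)ᵀ * rectDiag n d l =
      Matrix.diagonal fun k => if k.val < n then l k ^ 2 else 0 := by
  ext k m
  simp only [Matrix.mul_apply, Matrix.transpose_apply, rectDiag, Matrix.of_apply,
    Matrix.diagonal_apply]
  by_cases hk : k.val < n
  · rw [Finset.sum_eq_single (⟨k, hk⟩ : Fin n)]
    · by_cases hkm : k = m
      · simp [hkm, sq, hkm ▸ hk]
      · have : k.val ≠ m.val := fun h => hkm (Fin.ext h)
        simp [hkm, this]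
    · intro i _ hi
      have : i.val ≠ k.val := fun h => hi (Fin.ext h)
      simp [this]
    · simp
  · rw [Finset.sum_eq_zero]
    · simp [hk]
    · intro i _
      have : i.val ≠ k.val := fun h => hk (h ▸ i.isLt)
      simp [this]

theorem diagonal_mul_rectDiag_transpose {l l' : Fin d → ℝ}
    (h : ∀ k : Fin d, k.val < n → l k ^ 2 * l' k = l k) :
    (Matrix.diagonal fun k : Fin d => if k.val < n then l k ^ 2 else 0) * (rectDiag n d l')ᵀ =
      (rectDiag n d l)ᵀ := by
  ext k i
  rw [Matrix.diagonal_mul]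
  simp only [Matrix.transpose_apply, rectDiag, Matrix.of_apply]
  by_cases hik : i.val = k.val
  · have hk : k.val < n := hik ▸ i.isLt
    simp [hik, hk, h k hk]
  · simp [hik]

/-- The truncated pseudo-inverse of a matrix with large singular values solves the normal
equations. -/
theorem IsSVD.transpose_mul_mul_pinv {A : Matrix (Fin n) (Fin d) ℝ} {U : Matrix (Fin n) (Fin n) ℝ}
    {l : Fin d → ℝ} {V : Matrix (Fin d) (Fin d) ℝ} (h : IsSVD A U l V) {L tau : ℝ} (hL : 0 < L)
    (htau : tau ^ 2 ≤ L) (hA : ∀ f : Fin d → ℝ, L * (f ⬝ᵥ f) ≤ (A *ᵥ f) ⬝ᵥ (A *ᵥ f)) :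
    Aᵀ * A * (V * (rectDiag n d fun k => if l k < tau then 0 else (l k)⁻¹)ᵀ * Uᵀ) = Aᵀ := by
  obtain ⟨hU, hV, hl, -, hA'⟩ := h
  have hUU : Uᵀ * U = 1 := by
    have := (Matrix.mem_orthogonalGroup_iff' (Fin n) ℝ).1 hU
    simpa [Matrix.star_eq_conjTranspose] using this
  have hVV : Vᵀ * V = 1 := by
    have := (Matrix.mem_orthogonalGroup_iff' (Fin d) ℝ).1 hV
    simpa [Matrix.star_eq_conjTranspose] using this
  have hAA : Aᵀ * A * V = V * Matrix.diagonal fun k => if k.val < n then l k ^ 2 else 0 := by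
    rw [← rectDiag_transpose_mul_rectDiag, hA']
    simp only [Matrix.transpose_mul, Matrix.transpose_transpose]
    calc V * ((rectDiag n d l)ᵀ * Uᵀ) * (U * rectDiag n d l * Vᵀ) * V
        = V * (rectDiag n d l)ᵀ * (Uᵀ * U) * rectDiag n d l * (Vᵀ * V) := by
          simp only [Matrix.mul_assoc]
      _ = _ := by rw [hUU, hVV, Matrix.mul_one, Matrix.mul_one, Matrix.mul_assoc]
  -- Testing coercivity on the columns of `V` bounds every occurring singular value below by `√L`.
  -- As `tau² ≤ L`, the truncation is then inactive.
  have hsing : ∀ k : Fin d, k.val < n → L ≤ l k ^ 2 := by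
    intro k hk
    have h1 := hA (V *ᵥ Pi.single k 1)
    have h2 : (V *ᵥ Pi.single k 1) ⬝ᵥ (V *ᵥ Pi.single k 1) = 1 := by
      rw [Matrix.dotProduct_mulVec, ← Matrix.mulVec_transpose, Matrix.mulVec_mulVec, hVV]
      simp
    have h3 : (A *ᵥ (V *ᵥ Pi.single k 1)) ⬝ᵥ (A *ᵥ (V *ᵥ Pi.single k 1)) = l k ^ 2 := by
      rw [Matrix.dotProduct_mulVec, ← Matrix.mulVec_transpose, Matrix.mulVec_mulVec,
        Matrix.mulVec_mulVec, hAA, ← Matrix.mulVec_mulVec, dotProduct_comm,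
        Matrix.dotProduct_mulVec, ← Matrix.mulVec_transpose, Matrix.mulVec_mulVec, hVV,
        Matrix.one_mulVec]
      simp [hk]
    rw [h2, h3, mul_one] at h1
    exact h1
  rw [← Matrix.mul_assoc, ← Matrix.mul_assoc, hAA, Matrix.mul_assoc V,
    diagonal_mul_rectDiag_transpose, hA']
  · simp only [Matrix.transpose_mul, Matrix.transpose_transpose, Matrix.mul_assoc]
  · intro k hk
    have h1 := hsing k hk
    have hpos : l k ≠ 0 := by
      intro h0
      rw [h0] at h1
      norm_num at h1
      linarith
    have h2 : ¬ l k < tau := by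
      rw [not_lt]
      by_contra hlt
      nlinarith [hl k, htau.trans h1, not_le.1 hlt]
    rw [if_neg h2]
    field_simp

end SVD

/-! ### Second-stage estimators as solutions of normal equations. -/

section SecondStage

variable {n p : ℕ} {X : Matrix (Fin n) (Fin p) ℝ} {T : Finset (Fin p)} {L : ℝ}

theorem IsSelectMLS.normalEquations {y : Fin n → ℝ} {tau : ℝ} {b : Fin p → ℝ}
    (hb : IsSelectMLS X y T tau b) (h : GramCoercive X T L) (hL : 0 < L) (hn : 0 < n)
    (htau : tau ^ 2 ≤ L) : NormalEquations X y T 0 b := by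
  obtain ⟨hout, U, l, V, hsvd, heq⟩ := hb
  refine ⟨hout, fun j hj => ?_⟩
  have hn' : (0 : ℝ) < n := by positivity
  have hs : (1 / √(n : ℝ)) * (1 / √(n : ℝ)) = 1 / n := by
    rw [div_mul_div_comm, Real.mul_self_sqrt hn'.le, one_mul]
  have hs0 : (1 / √(n : ℝ)) ≠ 0 := by positivity
  have hA : ∀ f : Fin T.card → ℝ, L * (f ⬝ᵥ f) ≤
      (((1 / √(n : ℝ)) • colsFin X T) *ᵥ f) ⬝ᵥ (((1 / √(n : ℝ)) • colsFin X T) *ᵥ f) := by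
    intro f
    rw [Matrix.smul_mulVec, smul_dotProduct, dotProduct_smul, smul_eq_mul, smul_eq_mul,
      ← mul_assoc, hs, one_div_mul_eq_div, le_div_iff₀ hn']
    -- Coercivity is stated for vectors indexed by `T`; `e` carries it over to `Fin T.card`.
    let e := (T.orderIsoOfFin rfl).toEquiv
    let v : Fin p → ℝ := fun j => if hj : j ∈ T then f (e.symm ⟨j, hj⟩) else 0
    have hv : ∀ j, j ∉ T → v j = 0 := fun j hj => by simp only [v, dif_neg hj]
    have hvT : (fun k : T => v k) = f ∘ e.symm := by ext k; simp [v]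
    have hvf : (fun k => v (T.orderEmbOfFin rfl k)) = f := by
      ext k
      have : T.orderEmbOfFin rfl k = (e k : Fin p) := rfl
      rw [this]
      change (fun k : T => v k) (e k) = _
      rw [hvT]
      simp
    have h1 := h.mul_sum_sq_le hn hv
    rw [mulVec_eq_colsFin_mulVec X hv, hvf, hvT] at h1
    have h2 : (f ∘ e.symm) ⬝ᵥ (f ∘ e.symm) = f ⬝ᵥ f := by
      simp only [dotProduct, Function.comp_apply]
      exact e.symm.sum_comp fun k => f k * f k
    rw [h2] at h1
    linarith
  have key := hsvd.transpose_mul_mul_pinv hL htau hA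
  set A := (1 / √(n : ℝ)) • colsFin X T with hAdef
  have h1 : Aᵀ *ᵥ (A *ᵥ fun k => b (T.orderEmbOfFin rfl k)) = (1 / √(n : ℝ)) • Aᵀ *ᵥ y := by
    rw [heq, Matrix.mulVec_mulVec, Matrix.mulVec_smul, Matrix.mulVec_mulVec, key]
  rw [hAdef, Matrix.smul_mulVec, ← mulVec_eq_colsFin_mulVec X hout, Matrix.transpose_smul,
    Matrix.smul_mulVec, Matrix.mulVec_smul, Matrix.smul_mulVec] at h1
  have h2 := smul_right_injective _ hs0 (smul_right_injective _ hs0 h1)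
  rw [zero_mul, dotProduct_sub, sub_eq_zero, eq_comm]
  have h3 := congrFun h2 ((T.orderIsoOfFin rfl).symm ⟨j, hj⟩)
  have h4 : ∀ u, ((colsFin X T)ᵀ *ᵥ u) ((T.orderIsoOfFin rfl).symm ⟨j, hj⟩) = X.col j ⬝ᵥ u := by
    intro u
    have : T.orderEmbOfFin rfl ((T.orderIsoOfFin rfl).symm ⟨j, hj⟩) = j := by
      rw [← Finset.coe_orderIsoOfFin_apply]
      simp
    simp [Matrix.mulVec, colsFin, this, dotProduct, Matrix.col_apply]
  rw [h4, h4] at h3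
  exact h3

variable {β : Fin p → ℝ}

/-- A solution of the Ridge normal equations on the true support is close to least squares. -/
theorem NormalEquations.sq_mul_error_le (h : GramCoercive X (supp β) L) (hL : 0 < L) (hn : 0 < n)
    {m : ℝ} (hm : 0 ≤ m) {e : Fin n → ℝ} {b : Fin p → ℝ}
    (hb : NormalEquations X (response X β e) (supp β) m b) (j : supp β) :
    (L * (b j - β j - (olsMatrix X (supp β) *ᵥ e) j)) ^ 2 ≤ (m / n) ^ 2 *
      (((fun k : supp β => β k) + olsMatrix X (supp β) *ᵥ e) ⬝ᵥ
        ((fun k : supp β => β k) + olsMatrix X (supp β) *ᵥ e)) := by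
  have hn' : (n : ℝ) ≠ 0 := by positivity
  set Z := cols X (supp β)
  set B : supp β → ℝ := fun k => β k with hB
  set W := olsMatrix X (supp β) *ᵥ e with hW
  set D : supp β → ℝ := fun k => b k - β k - W k with hD
  have hbD : (fun k : supp β => b k) = D + (B + W) := by
    ext k
    simp [hD, hB]
  have hres : response X β e - X *ᵥ b = (e - Z *ᵥ W) - Z *ᵥ D := by
    rw [response, mulVec_eq_cols_mulVec X hb.1, hbD, Matrix.mulVec_add, Matrix.mulVec_add,
      mulVec_eq_cols_mulVec X fun j hj => eq_zero_of_notMem_supp hj]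
    abel
  have h1 : Zᵀ *ᵥ ((e - Z *ᵥ W) - Z *ᵥ D) = m • (D + (B + W)) := by
    ext k
    rw [← hbD, ← hres]
    exact hb.2 k k.2
  rw [Matrix.mulVec_sub, Matrix.mulVec_sub, hW, Matrix.mulVec_mulVec, Matrix.mulVec_mulVec,
    h.transpose_mul_ols hL hn, sub_self, zero_sub, ← hW] at h1
  have h2 : gram X (supp β) (supp β) *ᵥ D = -(m / n) • (D + (B + W)) := by
    rw [gram, Matrix.smul_mulVec, ← Matrix.mulVec_mulVec, neg_eq_iff_eq_neg.1 h1,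
      smul_neg, smul_smul, neg_smul]
    congr 2
    ring
  -- The contribution `-(m / n) ‖D‖²` has the favourable sign and is dropped.
  have h3 : L * (D ⬝ᵥ D) ≤ D ⬝ᵥ (-(m / n) • (B + W)) := by
    have h4 := h D
    rw [h2, smul_add, dotProduct_add, dotProduct_smul, smul_eq_mul] at h4
    have h5 : 0 ≤ m / n * (D ⬝ᵥ D) :=
      mul_nonneg (div_nonneg hm (Nat.cast_nonneg n)) (dotProduct_self_nonneg' D)
    linarith
  have h6 := sq_mul_dotProduct_le hL.le h3
  rw [smul_dotProduct, dotProduct_smul, smul_eq_mul, smul_eq_mul] at h6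
  have h7 := mul_le_mul_of_nonneg_left (sq_le_dotProduct_self D j) (sq_nonneg L)
  have h8 : (L * D j) ^ 2 = L ^ 2 * D j ^ 2 := by ring
  change (L * D j) ^ 2 ≤ _
  rw [h8]
  linarith

end SecondStage

end PostLasso

namespace PostLasso

/-! ### Laws, tails and anti-concentration of linear images of the noise. -/

section Gaussian

/-- The slack `v ≤ c` lets tail bounds be stated with an upper bound for the variance. -/
theorem hasSubgaussianMGF_of_hasLaw {Ω : Type*} [MeasurableSpace Ω]
    {P : Measure Ω} {Y : Ω → ℝ} {v c : ℝ≥0} (h : HasLaw Y (gaussianReal 0 v) P)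
    (hv : v ≤ c) : HasSubgaussianMGF Y c P where
  integrable_exp_mul t := by
    have := integrable_exp_mul_gaussianReal (μ := 0) (v := v) t
    rw [← h.map_eq] at this
    exact this.comp_aemeasurable h.aemeasurable
  mgf_le t := by
    rw [mgf_gaussianReal h.map_eq, zero_mul, zero_add]
    have : (v : ℝ) ≤ c := hv
    gcongr

variable {Ω : Type*} [MeasurableSpace Ω] {P : Measure Ω} [IsProbabilityMeasure P] {n p : ℕ}
  {ε : Fin n → Ω → ℝ} {σ : ℝ≥0}

theorem hasLaw_dotProduct (hi : iIndepFun ε P)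
    (hg : ∀ i, HasLaw (ε i) (gaussianReal 0 (σ ^ 2)) P) (a : Fin n → ℝ) :
    HasLaw (fun ω => a ⬝ᵥ fun i => ε i ω)
      (gaussianReal 0 (σ ^ 2 * (a ⬝ᵥ a).toNNReal)) P := by
  have hm : ∀ i, AEMeasurable (fun ω => a i * ε i ω) P :=
    fun i => (hg i).aemeasurable.const_mul _
  have hmeas : AEMeasurable (fun ω => a ⬝ᵥ fun i => ε i ω) P :=
    Finset.aemeasurable_fun_sum _ fun i _ => hm i
  refine ⟨hmeas, ?_⟩
  have : IsProbabilityMeasure (P.map fun ω => a ⬝ᵥ fun i => ε i ω) :=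
    Measure.isProbabilityMeasure_map hmeas
  refine Measure.ext_of_charFun ?_
  have hi' : iIndepFun (fun i ω => a i * ε i ω) P :=
    hi.comp (fun i x => a i * x) fun i => measurable_const_mul _
  have h1 := hi'.charFun_map_fun_sum_eq_prod hm
  simp only [dotProduct] at h1 ⊢
  rw [h1]
  ext t
  rw [Finset.prod_apply, charFun_gaussianReal]
  have h2 : ∀ i, charFun (P.map fun ω => a i * ε i ω) t =
      Complex.exp (-((σ : ℝ) ^ 2 * (a i * a i) * t ^ 2 / 2 : ℝ)) := by
    intro i
    rw [(gaussianReal_const_mul (hg i) (a i)).map_eq, charFun_gaussianReal]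
    congr 1
    push_cast [NNReal.coe_mk]
    ring
  simp only [h2]
  rw [← Complex.exp_sum]
  congr 1
  have h3 : 0 ≤ ∑ i, a i * a i := dotProduct_self_nonneg' a
  rw [NNReal.coe_mul, Real.coe_toNNReal _ h3]
  push_cast
  simp only [mul_zero, zero_mul, zero_sub, Finset.sum_neg_distrib, Finset.mul_sum,
    Finset.sum_mul, Finset.sum_div]

theorem measureReal_le_abs_dotProduct (hi : iIndepFun ε P)
    (hg : ∀ i, HasLaw (ε i) (gaussianReal 0 (σ ^ 2)) P) {a : Fin n → ℝ} {V s : ℝ}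
    (hV : a ⬝ᵥ a ≤ V) (hs : 0 ≤ s) :
    P.real {ω | s ≤ |a ⬝ᵥ fun i => ε i ω|} ≤ 2 * Real.exp (-s ^ 2 / (2 * (σ ^ 2 * V))) := by
  have hV0 : 0 ≤ V := (dotProduct_self_nonneg' a).trans hV
  have h := hasSubgaussianMGF_of_hasLaw (c := σ ^ 2 * V.toNNReal) (hasLaw_dotProduct hi hg a)
    (by gcongr)
  have h1 := h.measure_ge_le hs
  have h2 := h.neg.measure_ge_le hs
  rw [NNReal.coe_mul, Real.coe_toNNReal _ hV0, NNReal.coe_pow] at h1 h2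
  have hsub : {ω | s ≤ |a ⬝ᵥ fun i => ε i ω|} ⊆ {ω | s ≤ a ⬝ᵥ fun i => ε i ω} ∪
      {ω | s ≤ (-fun ω => a ⬝ᵥ fun i => ε i ω) ω} := by
    intro ω hω
    simp only [Set.mem_union, Set.mem_ofPred_eq] at hω ⊢
    exact le_abs.1 hω
  have h3 := (measureReal_mono (μ := P) hsub).trans (measureReal_union_le _ _)
  linarith

theorem gaussianReal_real_Icc_le {v : ℝ≥0} (hσ : 0 < σ) (hv : σ ^ 2 ≤ v) (t : ℝ) {δ : ℝ}
    (hδ : 0 ≤ δ) : (gaussianReal 0 v).real (Set.Icc (t - δ) (t + δ)) ≤ δ / σ := by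
  have hv0 : v ≠ 0 := (lt_of_lt_of_le (by positivity) hv).ne'
  have hσ' : (0 : ℝ) < σ := hσ
  have hvσ : (σ : ℝ) ^ 2 ≤ v := by exact_mod_cast hv
  rw [measureReal_def, gaussianReal_apply_eq_integral _ hv0,
    ENNReal.toReal_ofReal (integral_nonneg fun x => gaussianPDFReal_nonneg _ _ _)]
  have hpdf : ∀ x, gaussianPDFReal 0 v x ≤ 1 / (2 * σ) := by
    intro x
    rw [gaussianPDFReal, ← one_div]
    have h1 : Real.exp (-(x - 0) ^ 2 / (2 * v)) ≤ 1 := by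
      rw [Real.exp_le_one_iff, neg_div]
      exact neg_nonpos.2 (by positivity)
    -- `2π ≥ 4` and `v ≥ σ²`. The density is thus at most `1 / (2σ)`, and the interval has length
    -- `2δ`.
    have h2 : 2 * (σ : ℝ) ≤ √(2 * Real.pi * v) := by
      refine Real.le_sqrt_of_sq_le ?_
      nlinarith [Real.pi_gt_three]
    calc _ ≤ 1 / √(2 * Real.pi * v) * 1 := by gcongr
      _ ≤ _ := by rw [mul_one]; gcongr
  calc ∫ x in Set.Icc (t - δ) (t + δ), gaussianPDFReal 0 v x
      ≤ ∫ x in Set.Icc (t - δ) (t + δ), 1 / (2 * (σ : ℝ)) :=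
        setIntegral_mono (integrable_gaussianPDFReal _ _).integrableOn
          (integrableOn_const (by simp)) hpdf
    _ = δ / σ := by
        rw [setIntegral_const, measureReal_def, Real.volume_Icc,
          ENNReal.toReal_ofReal (by linarith), smul_eq_mul]
        field_simp
        ring

theorem measureReal_abs_dotProduct_sub_le (hi : iIndepFun ε P)
    (hg : ∀ i, HasLaw (ε i) (gaussianReal 0 (σ ^ 2)) P) (hσ : 0 < σ) {a : Fin n → ℝ}
    (ha : 1 ≤ a ⬝ᵥ a) (t : ℝ) {δ : ℝ} (hδ : 0 ≤ δ) :
    P.real {ω | |(a ⬝ᵥ fun i => ε i ω) - t| ≤ δ} ≤ δ / σ := by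
  have h := (hasLaw_dotProduct hi hg a).measureReal_eq (p := fun x => x ∈ Set.Icc (t - δ) (t + δ))
    measurableSet_Icc
  have h2 : {ω | |(a ⬝ᵥ fun i => ε i ω) - t| ≤ δ} =
      {ω | (a ⬝ᵥ fun i => ε i ω) ∈ Set.Icc (t - δ) (t + δ)} := by
    ext ω
    simp only [Set.mem_ofPred_eq, abs_le, Set.mem_Icc]
    constructor <;> rintro ⟨h1, h2⟩ <;> constructor <;> linarith
  rw [h2, h]
  refine gaussianReal_real_Icc_le hσ ?_ t hδ
  exact le_mul_of_one_le_right zero_le (by simpa using ha)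

/-- Cramér-Wold: the characteristic function at `t` is that of the scalar `(Aᵀ t) · ε` at `1`. -/
theorem hasLaw_mulVec (hi : iIndepFun ε P) (hg : ∀ i, HasLaw (ε i) (gaussianReal 0 (σ ^ 2)) P)
    {ι : Type*} [Fintype ι] [DecidableEq ι] (A : Matrix ι (Fin n) ℝ) :
    HasLaw (fun ω => WithLp.toLp 2 (A *ᵥ fun i => ε i ω))
      (multivariateGaussian (0 : EuclideanSpace ℝ ι) ((σ : ℝ) ^ 2 • (A * Aᵀ))) P := by
  have hm : ∀ j, AEMeasurable (fun ω => (A *ᵥ fun i => ε i ω) j) P :=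
    fun j => (hasLaw_dotProduct hi hg (A j)).aemeasurable
  have hmeas : AEMeasurable (fun ω => WithLp.toLp 2 (A *ᵥ fun i => ε i ω)) P :=
    (WithLp.measurable_toLp 2 _).comp_aemeasurable (aemeasurable_pi_lambda _ hm)
  refine ⟨hmeas, ?_⟩
  have : IsProbabilityMeasure (P.map fun ω => WithLp.toLp 2 (A *ᵥ fun i => ε i ω)) :=
    Measure.isProbabilityMeasure_map hmeas
  have hpsd : ((σ : ℝ) ^ 2 • (A * Aᵀ)).PosSemidef := by
    have := Matrix.posSemidef_self_mul_conjTranspose A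
    rw [Matrix.conjTranspose_eq_transpose_of_trivial] at this
    exact this.smul (by positivity)
  refine Measure.ext_of_charFun (funext fun t => ?_)
  rw [charFun_multivariateGaussian hpsd]
  set a : Fin n → ℝ := Aᵀ *ᵥ (WithLp.ofLp t) with ha
  have h1 : charFun (P.map fun ω => WithLp.toLp 2 (A *ᵥ fun i => ε i ω)) t =
      charFun (P.map fun ω => a ⬝ᵥ fun i => ε i ω) 1 := by
    rw [charFun_apply, charFun_apply_real, integral_map hmeas (by fun_prop),
      integral_map (hasLaw_dotProduct hi hg a).aemeasurable (by fun_prop)]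
    congr 1
    ext ω
    congr 2
    simp only [EuclideanSpace.inner_eq_star_dotProduct, star_trivial, Complex.ofReal_one, one_mul]
    rw [Matrix.dotProduct_mulVec, ← Matrix.mulVec_transpose]
  have h2 : a ⬝ᵥ a = WithLp.ofLp t ⬝ᵥ (A * Aᵀ) *ᵥ WithLp.ofLp t := by
    rw [← Matrix.mulVec_mulVec, Matrix.dotProduct_mulVec _ A, ← Matrix.mulVec_transpose]
  rw [h1, (hasLaw_dotProduct hi hg a).map_eq, charFun_gaussianReal, NNReal.coe_mul,
    Real.coe_toNNReal _ (dotProduct_self_nonneg' a), h2, Matrix.smul_mulVec, dotProduct_smul]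
  congr 1
  simp

end Gaussian

/-! ### Finite-sample bounds for the distribution function and the good event. -/

section Bounds

variable {Ω : Type*} [MeasurableSpace Ω] {P : Measure Ω} [IsProbabilityMeasure P] {n p : ℕ}
  {ε : Fin n → Ω → ℝ} {σ : ℝ≥0} {X : Matrix (Fin n) (Fin p) ℝ} {β : Fin p → ℝ} {L : ℝ}

theorem dotProduct_olsMatrix_self {T : Finset (Fin p)} (j : T) :
    olsMatrix X T j ⬝ᵥ olsMatrix X T j = ∑ i, olsMatrix X T j i ^ 2 := by
  simp [dotProduct, sq]

/-- The scaled least squares error is exactly Gaussian with the target covariance, so the limit law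
lives on the same probability space as the estimator. -/
theorem oracleCDF_eq (hi : iIndepFun ε P) (hg : ∀ i, HasLaw (ε i) (gaussianReal 0 (σ ^ 2)) P)
    (h : GramCoercive X (supp β) L) (hL : 0 < L) (hn : 0 < n) (t : supp β → ℝ) :
    oracleCDF X β σ t =
      P.real {ω | ∀ j, √(n : ℝ) * (olsMatrix X (supp β) *ᵥ fun i => ε i ω) j ≤ t j} := by
  have hn' : (n : ℝ) ≠ 0 := by positivity
  have h1 := hasLaw_mulVec hi hg (√(n : ℝ) • olsMatrix X (supp β))
  have h2 : (√(n : ℝ) • olsMatrix X (supp β)) * (√(n : ℝ) • olsMatrix X (supp β))ᵀ =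
      (gram X (supp β) (supp β))⁻¹ := by
    rw [Matrix.transpose_smul, Matrix.smul_mul, Matrix.mul_smul, h.olsMatrix_mul_transpose hL,
      smul_smul, smul_smul, Real.mul_self_sqrt (Nat.cast_nonneg n), mul_one_div_cancel hn',
      one_smul]
  rw [h2] at h1
  have hms : MeasurableSet {z : EuclideanSpace ℝ (supp β) | ∀ j, z j ≤ t j} := by
    rw [Set.ofPred_forall]
    exact MeasurableSet.iInter fun j => measurableSet_le (by fun_prop) measurable_const
  rw [oracleCDF, ← h1.measureReal_eq hms]
  simp only [Matrix.smul_mulVec, Pi.smul_apply, smul_eq_mul]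

/-- An estimator that is uniformly close to the oracle on an event `G` has almost the same
distribution function. -/
theorem abs_errorCDF_sub_oracleCDF_le (hi : iIndepFun ε P)
    (hg : ∀ i, HasLaw (ε i) (gaussianReal 0 (σ ^ 2)) P) (hσ : 0 < σ)
    (h : GramCoercive X (supp β) L) (hL : 0 < L) (hn : 0 < n)
    (hX : ∀ j, ∑ i, X i j ^ 2 = n) {bt : Ω → Fin p → ℝ} {δ : ℝ} (hδ : 0 ≤ δ) {G : Set Ω}
    (hG : ∀ ω ∈ G, ∀ j : supp β, |√(n : ℝ) * (bt ω j - β j) -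
      √(n : ℝ) * (olsMatrix X (supp β) *ᵥ fun i => ε i ω) j| ≤ δ) (t : supp β → ℝ) :
    |errorCDF P n β bt t - oracleCDF X β σ t| ≤ P.real Gᶜ + (supp β).card * (δ / σ) := by
  rw [oracleCDF_eq hi hg h hL hn, errorCDF]
  set W : Ω → supp β → ℝ :=
    fun ω j => √(n : ℝ) * (olsMatrix X (supp β) *ᵥ fun i => ε i ω) j with hW
  -- The two orthant events can differ on `G` only if some `W j` lies within `δ` of its threshold `t
  -- j`.
  set B : supp β → Set Ω := fun j => {ω | |W ω j - t j| ≤ δ} with hB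
  have hBj : ∀ j, P.real (B j) ≤ δ / σ := by
    intro j
    have h1 := measureReal_abs_dotProduct_sub_le hi hg hσ (a := √(n : ℝ) • olsMatrix X (supp β) j)
      (by
        rw [smul_dotProduct, dotProduct_smul, smul_eq_mul, smul_eq_mul, ← mul_assoc,
          Real.mul_self_sqrt (Nat.cast_nonneg n), dotProduct_olsMatrix_self]
        exact h.one_le_sum_olsMatrix_sq hL j (hX j)) (t j) hδ
    simp only [smul_dotProduct, smul_eq_mul] at h1
    exact h1
  have hU : P.real (⋃ j, B j) ≤ (supp β).card * (δ / σ) := by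
    refine (measureReal_iUnion_fintype_le B).trans ((Finset.sum_le_sum fun j _ => hBj j).trans ?_)
    simp
  have h1 : {ω | ∀ j : supp β, √(n : ℝ) * (bt ω j - β j) ≤ t j} ⊆
      {ω | ∀ j, W ω j ≤ t j} ∪ (Gᶜ ∪ ⋃ j, B j) := by
    intro ω hω
    by_contra hcon
    simp only [Set.mem_union, Set.mem_ofPred_eq, not_or, Set.mem_compl_iff, not_not,
      Set.mem_iUnion, not_forall, not_exists, not_le, hB] at hcon
    obtain ⟨⟨j, hj⟩, hωG, hno⟩ := hcon
    have h2 := abs_le.1 (hG ω hωG j)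
    have h3 := hno j
    have h4 := hω j
    rw [abs_of_pos (by linarith)] at h3
    change _ ≤ _ - W ω j ∧ _ at h2
    linarith [h2.1]
  have h2 : {ω | ∀ j, W ω j ≤ t j} ⊆
      {ω | ∀ j : supp β, √(n : ℝ) * (bt ω j - β j) ≤ t j} ∪ (Gᶜ ∪ ⋃ j, B j) := by
    intro ω hω
    by_contra hcon
    simp only [Set.mem_union, Set.mem_ofPred_eq, not_or, Set.mem_compl_iff, not_not,
      Set.mem_iUnion, not_forall, not_exists, not_le, hB] at hcon
    obtain ⟨⟨j, hj⟩, hωG, hno⟩ := hcon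
    have h2 := abs_le.1 (hG ω hωG j)
    have h3 := hno j
    have h4 := hω j
    rw [abs_of_nonpos (by linarith)] at h3
    change _ ∧ _ - W ω j ≤ _ at h2
    linarith [h2.2]
  have hR : P.real (Gᶜ ∪ ⋃ j, B j) ≤ P.real Gᶜ + (supp β).card * (δ / σ) :=
    (measureReal_union_le _ _).trans (by linarith)
  have h3 := (measureReal_mono (μ := P) h1).trans (measureReal_union_le _ _)
  have h4 := (measureReal_mono (μ := P) h2).trans (measureReal_union_le _ _)
  rw [abs_le]
  constructor <;> linarith

/-- The event that the noise is small relative to the signal on the support and to the penalty off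
the support. -/
def goodEvent (X : Matrix (Fin n) (Fin p) ℝ) (β : Fin p → ℝ) (ε : Fin n → Ω → ℝ) (r : ℝ) :
    Set Ω :=
  {ω | (∀ j : supp β, |(olsMatrix X (supp β) *ᵥ fun i => ε i ω) j| < |β j| / 2) ∧
    ∀ j, j ∉ supp β → |residualCol X (supp β) j ⬝ᵥ fun i => ε i ω| < r}

theorem measureReal_compl_goodEvent_le (hi : iIndepFun ε P)
    (hg : ∀ i, HasLaw (ε i) (gaussianReal 0 (σ ^ 2)) P)
    (h : GramCoercive X (supp β) L) (hL : 0 < L) (hn : 0 < n)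
    (hX : ∀ j, ∑ i, X i j ^ 2 = n) {m r : ℝ} (hm : 0 ≤ m) (hr : 0 ≤ r)
    (hβ : ∀ j ∈ supp β, m ≤ |β j|) :
    P.real (goodEvent X β ε r)ᶜ ≤ p * (2 * Real.exp (-(m / 2) ^ 2 / (2 * (σ ^ 2 * (1 / (n * L)))))
      + 2 * Real.exp (-r ^ 2 / (2 * (σ ^ 2 * n)))) := by
  classical
  let a : Fin p → Fin n → ℝ := fun j => if hj : j ∈ supp β then olsMatrix X (supp β) ⟨j, hj⟩
    else residualCol X (supp β) j
  let B : Fin p → Set Ω := fun j => {ω | (if j ∈ supp β then m / 2 else r) ≤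
    |a j ⬝ᵥ fun i => ε i ω|}
  have hsub : (goodEvent X β ε r)ᶜ ⊆ ⋃ j, B j := by
    intro ω hω
    by_contra hcon
    simp only [Set.mem_iUnion, not_exists, B, Set.mem_ofPred_eq, not_le] at hcon
    refine hω ⟨fun j => ?_, fun j hj => ?_⟩
    · have h1 := hcon j
      simp only [j.2, if_true, a, dif_pos] at h1
      have h2 := hβ j j.2
      change |olsMatrix X (supp β) j ⬝ᵥ _| < _
      linarith
    · have h1 := hcon j
      simpa only [hj, if_false, a, dif_neg, not_false_eq_true] using h1
  -- Each index is charged both tail terms, so the union bound is simply `p` times one quantity.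
  have hB : ∀ j, P.real (B j) ≤
      2 * Real.exp (-(m / 2) ^ 2 / (2 * (σ ^ 2 * (1 / (n * L))))) +
      2 * Real.exp (-r ^ 2 / (2 * (σ ^ 2 * n))) := by
    intro j
    by_cases hj : j ∈ supp β
    · have h1 := measureReal_le_abs_dotProduct hi hg (a := olsMatrix X (supp β) ⟨j, hj⟩)
        (V := 1 / (n * L)) (s := m / 2)
        (by rw [dotProduct_olsMatrix_self]; exact h.sum_olsMatrix_sq_le hL _) (by positivity)
      simp only [B, a, hj, if_true, dif_pos]
      have := Real.exp_pos (-r ^ 2 / (2 * (σ ^ 2 * n)))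
      linarith
    · have h1 := measureReal_le_abs_dotProduct hi hg (a := residualCol X (supp β) j)
        (V := n) (s := r)
        (by
          refine (h.dotProduct_residualCol_le hL hn j).trans_eq ?_
          rw [← hX j]
          simp [dotProduct, sq]) hr
      simp only [B, a, hj, if_false, dif_neg, not_false_eq_true]
      have := Real.exp_pos (-(m / 2) ^ 2 / (2 * (σ ^ 2 * (1 / (n * L)))))
      linarith
  refine (measureReal_mono hsub).trans ((measureReal_iUnion_fintype_le B).trans
    ((Finset.sum_le_sum fun j _ => hB j).trans_eq ?_))
  rw [Finset.sum_const, Finset.card_univ, Fintype.card_fin, nsmul_eq_mul]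

end Bounds

end PostLasso

namespace PostLasso

/-! ### Asymptotic comparison of powers and exponentials. -/

section Rates

theorem tendsto_natCast_rpow_atTop {c : ℝ} (hc : 0 < c) :
    Tendsto (fun n : ℕ => (n : ℝ) ^ c) atTop atTop :=
  (tendsto_rpow_atTop hc).comp tendsto_natCast_atTop_atTop

theorem tendsto_natCast_rpow_zero {c : ℝ} (hc : c < 0) :
    Tendsto (fun n : ℕ => (n : ℝ) ^ c) atTop (𝓝 0) := by
  have := (tendsto_rpow_neg_atTop (neg_pos.2 hc)).comp (tendsto_natCast_atTop_atTop (R := ℝ))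
  simpa [Function.comp_def] using this

/-- The combined exponent is `n^c₂ (1 - a n^(c - c₂))`, which tends to `-∞`. -/
theorem tendsto_mul_exp_neg_rpow {p : ℕ → ℝ} {c₂ c a : ℝ}
    (hp : p =O[atTop] fun n : ℕ => Real.exp ((n : ℝ) ^ c₂)) (hc₂ : 0 < c₂) (hc : c₂ < c)
    (ha : 0 < a) :
    Tendsto (fun n : ℕ => p n * Real.exp (-(a * (n : ℝ) ^ c))) atTop (𝓝 0) := by
  refine (hp.mul (isBigO_refl (fun n : ℕ => Real.exp (-(a * (n : ℝ) ^ c))) atTop)).trans_tendsto ?_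
  simp only [← Real.exp_add]
  refine Real.tendsto_exp_atBot.comp ?_
  have h1 : Tendsto (fun n : ℕ => 1 + -(a * (n : ℝ) ^ (c - c₂))) atTop atBot :=
    tendsto_atBot_add_const_left _ _
      (tendsto_neg_atTop_atBot.comp ((tendsto_natCast_rpow_atTop (by linarith)).const_mul_atTop ha))
  refine ((tendsto_natCast_rpow_atTop hc₂).atTop_mul_atBot₀ h1).congr' ?_
  filter_upwards [eventually_gt_atTop 0] with n hn
  have hn' : (0 : ℝ) < n := by positivity
  have : (n : ℝ) ^ c = (n : ℝ) ^ c₂ * (n : ℝ) ^ (c - c₂) := by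
    rw [← Real.rpow_add hn']
    congr 1
    ring
  rw [this]
  ring

theorem sqrt_isBigO_rpow {s : ℕ → ℝ} {c : ℝ} (hs0 : ∀ n, 0 ≤ s n)
    (hs : s =O[atTop] fun n : ℕ => (n : ℝ) ^ c) :
    (fun n => √(s n)) =O[atTop] fun n : ℕ => (n : ℝ) ^ (c / 2) := by
  obtain ⟨K, hK⟩ := hs.bound
  refine IsBigO.of_bound √K ?_
  filter_upwards [hK] with n hn
  have hn0 : (0 : ℝ) ≤ n := Nat.cast_nonneg n
  rw [Real.norm_of_nonneg (hs0 n), Real.norm_of_nonneg (by positivity)] at hn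
  rw [Real.norm_of_nonneg (by positivity), Real.norm_of_nonneg (by positivity)]
  have h1 : (n : ℝ) ^ (c / 2) = √((n : ℝ) ^ c) := by
    rw [Real.sqrt_eq_rpow, ← Real.rpow_mul hn0]
    congr 1
    ring
  rw [h1, ← Real.sqrt_mul' _ (by positivity)]
  exact Real.sqrt_le_sqrt hn

theorem natCast_rpow_isLittleO {a b : ℝ} (h : a < b) :
    (fun n : ℕ => (n : ℝ) ^ a) =o[atTop] fun n : ℕ => (n : ℝ) ^ b := by
  refine isLittleO_of_tendsto' ?_ ?_
  · filter_upwards [eventually_gt_atTop 0] with n hn h0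
    have : (0 : ℝ) < (n : ℝ) ^ b := by positivity
    exact absurd h0 this.ne'
  · refine (tendsto_natCast_rpow_zero (sub_neg.2 h)).congr' ?_
    filter_upwards [eventually_gt_atTop 0] with n hn
    rw [Real.rpow_sub (by positivity)]

end Rates

/-! ### Deterministic consequences of the good event. -/

section Events

variable {n p : ℕ} {X : Matrix (Fin n) (Fin p) ℝ} {β : Fin p → ℝ} {L : ℝ}

theorem MinEigenvalueGE.gramCoercive (h : MinEigenvalueGE X β L) :
    GramCoercive X (supp β) L :=
  le_quadratic_form_of_le_eigenvalues _ h

theorem Standardized.sum_sq (h : Standardized X) (hn : 0 < n) (j : Fin p) :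
    ∑ i, X i j ^ 2 = n := by
  have hn' : (n : ℝ) ≠ 0 := by positivity
  have := (h j).2
  field_simp at this
  linarith

/-- The sign vector has Euclidean norm at most `√s`, and `C₁₁⁻¹` costs a factor `1 / L`. This `√s`
is why `c₄ < c₃ - c₁` is required. -/
theorem abs_dualVector_le (h : GramCoercive X (supp β) L) (hL : 0 < L) (j : supp β) :
    |dualVector X β j| ≤ √(supp β).card / L := by
  have h1 := h.sq_mul_inv_mulVec_le hL fun k => Real.sign (β k)
  have h2 := sq_le_dotProduct_self (dualVector X β) j
  have h3 : (fun k : supp β => Real.sign (β k)) ⬝ᵥ (fun k : supp β => Real.sign (β k)) ≤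
      (supp β).card := by
    have : ∀ k : supp β, Real.sign (β k) * Real.sign (β k) ≤ 1 := by
      intro k
      rw [← sq, sq_le_one_iff_abs_le_one]
      exact abs_real_sign_le_one _
    refine (Finset.sum_le_sum fun k _ => this k).trans ?_
    simp
  rw [le_div_iff₀ hL]
  refine Real.le_sqrt_of_sq_le ?_
  rw [mul_pow, sq_abs]
  have h4 := mul_le_mul_of_nonneg_left h2 (sq_nonneg L)
  change L ^ 2 * (dualVector X β ⬝ᵥ dualVector X β) ≤ _ at h1
  linarith

theorem goodEvent_subset {Ω : Type*} {ε : Fin n → Ω → ℝ} (h : GramCoercive X (supp β) L)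
    (hL : 0 < L) (hn : 0 < n) {lam η r : ℝ} (hlam : 0 < lam) (hIC : Irrepresentable X β η)
    (hr : r ≤ lam * η / 2)
    (hbias : ∀ j ∈ supp β, lam / n * (√(supp β).card / L) ≤ |β j|)
    {bhat : Ω → Fin p → ℝ}
    (hlasso : ∀ ω, IsLasso X (response X β fun i => ε i ω) lam (bhat ω)) :
    goodEvent X β ε r ⊆ {ω | supp (bhat ω) = supp β} := by
  intro ω hω
  refine supp_eq_of_isLasso h hL hn hlam hIC hω.1 (fun j => ?_)
    (fun j hj => (hω.2 j hj).trans_le hr) (hlasso ω)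
  have h1 := abs_dualVector_le h hL j
  have h2 := hbias j j.2
  have h3 : lam / (2 * n) * |dualVector X β j| ≤ lam / (2 * n) * (√(supp β).card / L) := by
    gcongr
  have h4 : lam / (2 * n) * (√(supp β).card / L) = (lam / n * (√(supp β).card / L)) / 2 := by
    field_simp
  linarith

theorem NormalEquations.abs_sub_le {Ω : Type*} {ε : Fin n → Ω → ℝ}
    (h : GramCoercive X (supp β) L) (hL : 0 < L) (hn : 0 < n) {m r : ℝ} (hm : 0 ≤ m) {ω : Ω}
    (hω : ω ∈ goodEvent X β ε r) {b : Fin p → ℝ}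
    (hb : NormalEquations X (response X β fun i => ε i ω) (supp β) m b) (j : supp β) :
    |√(n : ℝ) * (b j - β j) - √(n : ℝ) * (olsMatrix X (supp β) *ᵥ fun i => ε i ω) j| ≤
      2 * m * √((fun k : supp β => β k) ⬝ᵥ fun k : supp β => β k) / (√(n : ℝ) * L) := by
  have hn' : (0 : ℝ) < n := by positivity
  set W := olsMatrix X (supp β) *ᵥ fun i => ε i ω with hW
  set B : supp β → ℝ := fun k => β k with hB
  have h1 := hb.sq_mul_error_le h hL hn hm j
  -- On the good event the noise is dominated coordinatewise by the signal, so the Ridge error bound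
  -- becomes deterministic.
  have h2 : (B + W) ⬝ᵥ (B + W) ≤ 4 * (B ⬝ᵥ B) := by
    rw [dotProduct, dotProduct, Finset.mul_sum]
    refine Finset.sum_le_sum fun k _ => ?_
    have h3 : |W k| < |B k| / 2 := hω.1 k
    have h4 : |B k + W k| ≤ 2 * |B k| := by
      have := abs_add_le (B k) (W k)
      linarith [abs_nonneg (B k)]
    have h5 := pow_le_pow_left₀ (abs_nonneg _) h4 2
    rw [mul_pow, sq_abs, sq_abs] at h5
    simp only [Pi.add_apply]
    linarith
  have h3 : |L * (b j - β j - W j)| ≤ m / n * (2 * √(B ⬝ᵥ B)) := by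
    refine abs_le_of_sq_le_sq ?_ (by positivity)
    rw [mul_pow (m / n), mul_pow 2, Real.sq_sqrt (dotProduct_self_nonneg' B)]
    have := mul_le_mul_of_nonneg_left h2 (sq_nonneg (m / n))
    linarith
  rw [abs_mul, abs_of_pos hL] at h3
  rw [← mul_sub, abs_mul, abs_of_nonneg (Real.sqrt_nonneg _), le_div_iff₀ (by positivity)]
  calc √(n : ℝ) * |b j - β j - W j| * (√(n : ℝ) * L)
      = (√(n : ℝ) * √(n : ℝ)) * (L * |b j - β j - W j|) := by ring
    _ ≤ n * (m / n * (2 * √(B ⬝ᵥ B))) := by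
        rw [Real.mul_self_sqrt hn'.le]
        gcongr
    _ = _ := by field_simp

end Events

/-! ### Passage to the limit. -/

section Limit

variable {Ω : ℕ → Type*} [∀ n, MeasurableSpace (Ω n)] {P : ∀ n, Measure (Ω n)}
  [∀ n, IsProbabilityMeasure (P n)] {p : ℕ → ℕ} {X : ∀ n, Matrix (Fin n) (Fin (p n)) ℝ}
  {β : ∀ n, Fin (p n) → ℝ} {ε : ∀ n, Fin n → Ω n → ℝ} {σ : ℝ≥0}

/-- An event of probability tending to one that is eventually contained in `A n`. -/
theorem tendsto_measureReal_of_subset {G A : ∀ n, Set (Ω n)}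
    (hG : Tendsto (fun n => (P n).real (G n)ᶜ) atTop (𝓝 0)) (h : ∀ᶠ n in atTop, G n ⊆ A n) :
    Tendsto (fun n => (P n).real (A n)) atTop (𝓝 1) := by
  have h1 : Tendsto (fun n => 1 - (P n).real (G n)ᶜ) atTop (𝓝 1) := by
    simpa using tendsto_const_nhds.sub hG
  refine tendsto_of_tendsto_of_tendsto_of_le_of_le' h1 tendsto_const_nhds ?_
    (Eventually.of_forall fun n => measureReal_le_one)
  filter_upwards [h] with n hn
  -- Subadditivity in place of the complement rule avoids measurability of `G n`.
  have h2 := measureReal_union_le (μ := P n) (G n) (G n)ᶜ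
  rw [Set.union_compl_self, probReal_univ] at h2
  have h3 := measureReal_mono (μ := P n) hn
  linarith

/-- Second stage: estimators that solve the Ridge normal equations on the true support on an event
of probability tending to one are asymptotically equivalent to the oracle. -/
theorem tendsto_iSup_abs_errorCDF_sub {L : ℝ} {r m : ℕ → ℝ}
    (hi : ∀ n, iIndepFun (ε n) (P n))
    (hg : ∀ n i, HasLaw (ε n i) (gaussianReal 0 (σ ^ 2)) (P n)) (hσ : 0 < σ)
    (hX : ∀ᶠ n in atTop, Standardized (X n))
    (h : ∀ᶠ n in atTop, GramCoercive (X n) (supp (β n)) L) (hL : 0 < L) (hm : ∀ n, 0 ≤ m n)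
    (hG : Tendsto (fun n => (P n).real (goodEvent (X n) (β n) (ε n) (r n))ᶜ) atTop (𝓝 0))
    (hδ : Tendsto (fun n => ((supp (β n)).card : ℝ) * (2 * m n *
      √((fun k : supp (β n) => β n k) ⬝ᵥ fun k : supp (β n) => β n k) / (√(n : ℝ) * L)))
      atTop (𝓝 0))
    {bt : ∀ n, Ω n → Fin (p n) → ℝ}
    (hb : ∀ᶠ n in atTop, ∀ ω ∈ goodEvent (X n) (β n) (ε n) (r n),
      NormalEquations (X n) (response (X n) (β n) fun i => ε n i ω) (supp (β n)) (m n) (bt n ω)) :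
    Tendsto (fun n => ⨆ t, |errorCDF (P n) n (β n) (bt n) t - oracleCDF (X n) (β n) σ t|)
      atTop (𝓝 0) := by
  have hlim := hG.add (hδ.div_const (σ : ℝ))
  rw [zero_div, add_zero] at hlim
  refine tendsto_of_tendsto_of_tendsto_of_le_of_le' tendsto_const_nhds hlim
    (Eventually.of_forall fun n => Real.iSup_nonneg fun t => abs_nonneg _) ?_
  filter_upwards [hX, h, hb, eventually_gt_atTop 0] with n hXn hn hbn hn0
  have hmn := hm n
  refine ciSup_le fun t => ?_
  rw [mul_div_assoc]
  exact abs_errorCDF_sub_oracleCDF_le (hi n) (hg n) hσ hn hL hn0 (hXn.sum_sq hn0) (by positivity)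
    (fun ω hω j => (hbn ω hω).abs_sub_le hn hL hn0 hmn hω j) t

/-- On the support, squared signal over least squares variance is at least of order `n^c₃`. Off it,
squared threshold over `n` is of order `n^c₄`. Both powers exceed the `n^c₂` in the growth of `p`.
-/
theorem tendsto_measureReal_compl_goodEvent {L c₂ c₃ c₄ M K : ℝ}
    (hi : ∀ n, iIndepFun (ε n) (P n))
    (hg : ∀ n i, HasLaw (ε n i) (gaussianReal 0 (σ ^ 2)) (P n)) (hσ : 0 < σ)
    (hX : ∀ᶠ n in atTop, Standardized (X n))
    (h : ∀ᶠ n in atTop, GramCoercive (X n) (supp (β n)) L) (hL : 0 < L)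
    (hp : (fun n => (p n : ℝ)) =O[atTop] fun n : ℕ => Real.exp ((n : ℝ) ^ c₂))
    (hc₂ : 0 < c₂) (hc₃ : c₂ < c₃) (hc₄ : c₂ < c₄) (hM : 0 < M) (hK : 0 < K)
    (hmin : ∀ᶠ n : ℕ in atTop, ∀ j ∈ supp (β n), M * (n : ℝ) ^ ((c₃ - 1) / 2) ≤ |β n j|) :
    Tendsto (fun n => (P n).real
      (goodEvent (X n) (β n) (ε n) (K * (n : ℝ) ^ ((1 + c₄) / 2)))ᶜ) atTop (𝓝 0) := by
  have hσ' : (0 : ℝ) < σ := hσ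
  have h1 := tendsto_mul_exp_neg_rpow (a := M ^ 2 * L / (8 * σ ^ 2)) hp hc₂ hc₃ (by positivity)
  have h2 := tendsto_mul_exp_neg_rpow (a := K ^ 2 / (2 * σ ^ 2)) hp hc₂ hc₄ (by positivity)
  have hlim := (h1.const_mul 2).add (h2.const_mul 2)
  rw [mul_zero, add_zero] at hlim
  refine tendsto_of_tendsto_of_tendsto_of_le_of_le' tendsto_const_nhds hlim
    (Eventually.of_forall fun n => measureReal_nonneg) ?_
  filter_upwards [hX, h, hmin, eventually_gt_atTop 0] with n hXn hn hmn hn0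
  have hn' : (0 : ℝ) < n := by positivity
  refine (measureReal_compl_goodEvent_le (hi n) (hg n) hn hL hn0 (hXn.sum_sq hn0)
    (by positivity) (by positivity) hmn).trans_eq ?_
  have e1 : ((n : ℝ) ^ ((c₃ - 1) / 2)) ^ 2 = (n : ℝ) ^ c₃ / n := by
    rw [← Real.rpow_natCast, ← Real.rpow_mul hn'.le, ← Real.rpow_sub_one hn'.ne']
    congr 1
    push_cast
    ring
  have e2 : ((n : ℝ) ^ ((1 + c₄) / 2)) ^ 2 = (n : ℝ) ^ c₄ * n := by
    rw [← Real.rpow_natCast, ← Real.rpow_mul hn'.le, ← Real.rpow_add_one hn'.ne']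
    congr 1
    push_cast
    ring
  have e3 : -(M * (n : ℝ) ^ ((c₃ - 1) / 2) / 2) ^ 2 / (2 * ((σ : ℝ) ^ 2 * (1 / (n * L)))) =
      -(M ^ 2 * L / (8 * σ ^ 2) * (n : ℝ) ^ c₃) := by
    rw [div_pow, mul_pow, e1]
    field_simp
    norm_num
  have e4 : -(K * (n : ℝ) ^ ((1 + c₄) / 2)) ^ 2 / (2 * ((σ : ℝ) ^ 2 * n)) =
      -(K ^ 2 / (2 * σ ^ 2) * (n : ℝ) ^ c₄) := by
    rw [mul_pow, e2]
    field_simp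
  rw [e3, e4]
  ring

theorem eventually_bias_le {s lam : ℕ → ℝ} {c₁ c₃ c₄ M L : ℝ} (hs0 : ∀ n, 0 ≤ s n)
    (hs : s =O[atTop] fun n : ℕ => (n : ℝ) ^ c₁)
    (hlam : lam =O[atTop] fun n : ℕ => (n : ℝ) ^ ((1 + c₄) / 2)) (hc : c₄ < c₃ - c₁) (hM : 0 < M) :
    ∀ᶠ n : ℕ in atTop, lam n / n * (√(s n) / L) ≤ M * (n : ℝ) ^ ((c₃ - 1) / 2) := by
  have h1 : (fun n : ℕ => lam n / n * (√(s n) / L)) =O[atTop]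
      fun n : ℕ => (n : ℝ) ^ ((c₄ + c₁ - 1) / 2) := by
    have h2 := ((hlam.mul (sqrt_isBigO_rpow hs0 hs)).mul
      (isBigO_refl (fun n : ℕ => (n : ℝ)⁻¹) atTop)).const_mul_left L⁻¹
    refine (h2.congr_left fun n => ?_).trans_eventuallyEq ?_
    · field_simp
    · filter_upwards [eventually_gt_atTop 0] with n hn
      have hn' : (0 : ℝ) < n := by positivity
      rw [← Real.rpow_neg_one, ← Real.rpow_add hn', ← Real.rpow_add hn']
      congr 1
      ring
  have h3 := h1.trans_isLittleO (natCast_rpow_isLittleO (b := (c₃ - 1) / 2) (by linarith))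
  filter_upwards [h3.bound hM] with n hn
  have hpos : (0 : ℝ) ≤ (n : ℝ) ^ ((c₃ - 1) / 2) := by positivity
  rw [Real.norm_of_nonneg hpos] at hn
  exact (le_abs_self _).trans hn

theorem ridge_bias_tendsto {L c₁ : ℝ} {μ : ℕ → ℝ} (hL : 0 < L)
    (h : ∀ᶠ n in atTop, GramCoercive (X n) (supp (β n)) L)
    (hs : (fun n => ((supp (β n)).card : ℝ)) =O[atTop] fun n : ℕ => (n : ℝ) ^ c₁) (hc₁ : c₁ < 1)
    (hμ : μ =O[atTop] fun n : ℕ => 1 / (n : ℝ))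
    (hsig : (fun n : ℕ => (1 / (n : ℝ)) * ∑ i, (X n *ᵥ β n) i ^ 2) =O[atTop]
      fun n : ℕ => (n : ℝ)) :
    Tendsto (fun n => ((supp (β n)).card : ℝ) * (2 * μ n *
      √((fun k : supp (β n) => β n k) ⬝ᵥ fun k : supp (β n) => β n k) / (√(n : ℝ) * L)))
      atTop (𝓝 0) := by
  -- Coercivity gives `n L ‖β‖² ≤ ‖X β‖²`, so the signal condition implies `‖β‖ = O(√n)`.
  have hB : (fun n : ℕ => √((fun k : supp (β n) => β n k) ⬝ᵥ fun k : supp (β n) => β n k) / √n)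
      =O[atTop] fun _ => (1 : ℝ) := by
    obtain ⟨K, hK⟩ := hsig.bound
    refine IsBigO.of_bound √(K / L) ?_
    filter_upwards [hK, h, eventually_gt_atTop 0] with n hKn hn hn0
    have hn' : (0 : ℝ) < n := by positivity
    rw [Real.norm_of_nonneg (by positivity), Real.norm_of_nonneg hn'.le] at hKn
    rw [← Real.sqrt_div' _ hn'.le, norm_one, mul_one, Real.norm_of_nonneg (by positivity)]
    refine Real.sqrt_le_sqrt ?_
    have h1 := hn.mul_sum_sq_le hn0 (v := β n) fun j hj => eq_zero_of_notMem_supp hj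
    have h2 : (X n *ᵥ β n) ⬝ᵥ (X n *ᵥ β n) = ∑ i, (X n *ᵥ β n) i ^ 2 := by
      simp [dotProduct, sq]
    rw [h2] at h1
    rw [one_div_mul_eq_div, div_le_iff₀ hn'] at hKn
    rw [div_le_div_iff₀ hn' hL]
    have h3 := h1.trans hKn
    refine le_of_mul_le_mul_left ?_ hn'
    linarith
  have h1 := ((hs.mul hμ).mul hB).const_mul_left (2 / L)
  have h2 : Tendsto (fun n : ℕ => (n : ℝ) ^ c₁ * (1 / (n : ℝ)) * 1) atTop (𝓝 0) := by
    refine (tendsto_natCast_rpow_zero (sub_neg.2 hc₁)).congr' ?_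
    filter_upwards [eventually_gt_atTop 0] with n hn
    have hn' : (n : ℝ) ≠ 0 := by positivity
    rw [Real.rpow_sub_one hn', mul_one, mul_one_div]
  refine (h1.trans_tendsto h2).congr fun n => ?_
  simp only [div_eq_mul_inv, mul_inv]
  ring

end Limit

end PostLasso

theorem corollary2
    {Ω : ℕ → Type*} [∀ n, MeasurableSpace (Ω n)] (P : ∀ n, Measure (Ω n))
    [∀ n, IsProbabilityMeasure (P n)]
    -- the model: dimension, design, coefficients and noise for each sample size `n`
    (p : ℕ → ℕ) (X : ∀ n, Matrix (Fin n) (Fin (p n)) ℝ) (β : ∀ n, Fin (p n) → ℝ)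
    (ε : ∀ n, Fin n → Ω n → ℝ)
    -- the constants
    (σ : ℝ≥0) (c₁ c₂ c₃ c₄ Lmin M η : ℝ)
    -- the tuning parameters
    (lam τ μ : ℕ → ℝ) (hlam : ∀ n, 0 ≤ lam n) (hτ : ∀ n, 0 < n → 0 < τ n) (hμ : ∀ n, 0 ≤ μ n)
    -- (a) i.i.d. Gaussian noise
    (hσ : 0 < σ) (hindep : ∀ n, iIndepFun (ε n) (P n))
    (hgauss : ∀ n i, HasLaw (ε n i) (gaussianReal 0 (σ ^ 2)) (P n))
    -- (b) standardized predictors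
    (hstd : ∀ᶠ n in atTop, PostLasso.Standardized (X n))
    -- (c) smallest eigenvalue of `C₁₁`
    (hL : 0 < Lmin) (heig : ∀ᶠ n in atTop, PostLasso.MinEigenvalueGE (X n) (β n) Lmin)
    -- (d) sparsity and dimension
    (hc₁ : 0 ≤ c₁) (hc₁' : c₁ < 1) (hc₂ : 0 < c₂) (hc₂' : c₂ < 1 - c₁)
    (hs : (fun n => ((PostLasso.supp (β n)).card : ℝ)) =O[atTop] fun n : ℕ => (n : ℝ) ^ c₁)
    (hp : (fun n => (p n : ℝ)) =O[atTop] fun n : ℕ => Real.exp ((n : ℝ) ^ c₂))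
    -- (e) rates of the second-stage tuning parameters
    (hτrate : τ =Θ[atTop] fun n : ℕ => 1 / (n : ℝ))
    (hμrate : μ =Θ[atTop] fun n : ℕ => 1 / (n : ℝ))
    -- (i) minimal size of the nonzero coefficients
    (hc₃ : c₁ + c₂ < c₃) (hc₃' : c₃ ≤ 1) (hM : 0 < M)
    (hmin : ∀ᶠ n : ℕ in atTop, ∀ j ∈ PostLasso.supp (β n), M ≤ (n : ℝ) ^ ((1 - c₃) / 2) * |β n j|)
    -- (j) rate of the Lasso tuning parameter
    (hc₄ : c₂ < c₄) (hc₄' : c₄ < c₃ - c₁)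
    (hlamrate : lam =Θ[atTop] fun n : ℕ => (n : ℝ) ^ ((1 + c₄) / 2))
    -- Irrepresentable condition
    (hη : 0 < η) (hIC : ∀ᶠ n in atTop, PostLasso.Irrepresentable (X n) (β n) η)
    -- the first stage: a Lasso estimator
    (βhat : ∀ n, Ω n → Fin (p n) → ℝ) (hmeas : ∀ n, AEMeasurable (βhat n) (P n))
    (hlasso : ∀ n ω, PostLasso.IsLasso (X n)
      (PostLasso.response (X n) (β n) fun i => ε n i ω) (lam n) (βhat n ω)) :
    -- the Lasso selects the true predictors with probability tending to one
    Tendsto (fun n => (P n).real {ω | PostLasso.supp (βhat n ω) = PostLasso.supp (β n)})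
      atTop (𝓝 1) ∧
    -- Lasso+mLS
    (∀ βmls : ∀ n, Ω n → Fin (p n) → ℝ,
      (∀ n ω, PostLasso.IsSelectMLS (X n) (PostLasso.response (X n) (β n) fun i => ε n i ω)
        (PostLasso.supp (βhat n ω)) (τ n) (βmls n ω)) →
      Tendsto (fun n => ⨆ t, |PostLasso.errorCDF (P n) n (β n) (βmls n) t -
        PostLasso.oracleCDF (X n) (β n) σ t|) atTop (𝓝 0)) ∧
    -- Lasso+Ridge, under the additional condition (g)
    ((fun n : ℕ => (1 / (n : ℝ)) * ∑ i, (X n *ᵥ β n) i ^ 2) =O[atTop] (fun n : ℕ => (n : ℝ)) →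
      ∀ βridge : ∀ n, Ω n → Fin (p n) → ℝ,
      (∀ n ω, PostLasso.IsSelectRidge (X n) (PostLasso.response (X n) (β n) fun i => ε n i ω)
        (PostLasso.supp (βhat n ω)) (μ n) (βridge n ω)) →
      Tendsto (fun n => ⨆ t, |PostLasso.errorCDF (P n) n (β n) (βridge n) t -
        PostLasso.oracleCDF (X n) (β n) σ t|) atTop (𝓝 0)) := by
  have hgram : ∀ᶠ n in atTop, PostLasso.GramCoercive (X n) (PostLasso.supp (β n)) Lmin :=
    heig.mono fun n hn => hn.gramCoercive
  have hmin' : ∀ᶠ n : ℕ in atTop, ∀ j ∈ PostLasso.supp (β n),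
      M * (n : ℝ) ^ ((c₃ - 1) / 2) ≤ |β n j| := by
    filter_upwards [hmin, eventually_gt_atTop 0] with n hn hn0 j hj
    have hn' : (0 : ℝ) < n := by positivity
    have h1 := mul_le_mul_of_nonneg_right (hn j hj)
      (by positivity : 0 ≤ (n : ℝ) ^ ((c₃ - 1) / 2))
    have h2 : (n : ℝ) ^ ((1 - c₃) / 2) * (n : ℝ) ^ ((c₃ - 1) / 2) = 1 := by
      rw [← Real.rpow_add hn', ← add_div]
      simp
    rwa [mul_right_comm, h2, one_mul] at h1
  obtain ⟨k, hk, hlamk⟩ : ∃ k : ℝ, 0 < k ∧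
      ∀ᶠ n : ℕ in atTop, k * (n : ℝ) ^ ((1 + c₄) / 2) ≤ lam n := by
    obtain ⟨k, hk, hb⟩ := hlamrate.2.exists_pos
    refine ⟨k⁻¹, inv_pos.2 hk, ?_⟩
    filter_upwards [hb.bound] with n hn
    rw [Real.norm_of_nonneg (by positivity), Real.norm_of_nonneg (hlam n)] at hn
    rwa [inv_mul_le_iff₀ hk]
  -- This `K` keeps the off-support threshold below `lam n * η / 2`, as dual feasibility requires.
  have hG := PostLasso.tendsto_measureReal_compl_goodEvent (K := k * η / 2) hindep hgauss hσ hstd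
    hgram hL hp hc₂ (by linarith) hc₄ hM (by positivity) hmin'
  have hbias := PostLasso.eventually_bias_le (L := Lmin) (fun n => Nat.cast_nonneg _) hs hlamrate.1
    hc₄' hM
  have hsub : ∀ᶠ n : ℕ in atTop, PostLasso.goodEvent (X n) (β n) (ε n)
      (k * η / 2 * (n : ℝ) ^ ((1 + c₄) / 2)) ⊆
      {ω | PostLasso.supp (βhat n ω) = PostLasso.supp (β n)} := by
    filter_upwards [hgram, hIC, hmin', hlamk, hbias, eventually_gt_atTop 0]
      with n hgn hICn hmn hkn hbn hn0
    have hpow : 0 < k * (n : ℝ) ^ ((1 + c₄) / 2) := by positivity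
    refine PostLasso.goodEvent_subset hgn hL hn0 (hpow.trans_le hkn) hICn ?_
      (fun j hj => hbn.trans (hmn j hj)) (hlasso n)
    have := mul_le_mul_of_nonneg_right hkn hη.le
    linarith
  refine ⟨PostLasso.tendsto_measureReal_of_subset hG hsub, fun βmls hmls => ?_,
    fun hsig βridge hridge => ?_⟩
  -- With penalty `0` mLS coincides with least squares on the good event, once `τ n ^ 2 ≤ Lmin`.
  · refine PostLasso.tendsto_iSup_abs_errorCDF_sub (m := fun _ => 0) hindep hgauss hσ hstd hgram hL
      (fun _ => le_rfl) hG (by simp) ?_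
    have hτ0 : Tendsto (fun n => τ n ^ 2) atTop (𝓝 0) := by
      simpa using (hτrate.1.trans_tendsto tendsto_one_div_atTop_nhds_zero_nat).pow 2
    filter_upwards [hsub, hgram, eventually_gt_atTop 0, hτ0.eventually_le_const hL]
      with n hsn hgn hn0 hτn ω hω
    have h1 := hmls n ω
    rw [show PostLasso.supp (βhat n ω) = PostLasso.supp (β n) from hsn hω] at h1
    exact h1.normalEquations hgn hL hn0 hτn
  · refine PostLasso.tendsto_iSup_abs_errorCDF_sub hindep hgauss hσ hstd hgram hL hμ hG
      (PostLasso.ridge_bias_tendsto hL hgram hs hc₁' hμrate.1 hsig) ?_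
    filter_upwards [hsub] with n hsn ω hω
    have h1 := hridge n ω
    rw [show PostLasso.supp (βhat n ω) = PostLasso.supp (β n) from hsn hω] at h1
    exact h1.normalEquations
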